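/- Let $r\in\mathbb N$, $K=(k_{ij})\in\mathbb R^{r\times r}$ and $\Lambda=\operatorname{diag}(\lambda_1,\dots,\lambda_r)$ be real matrices such that (H1) $k_{ij}\ge 0$ for $i\ne j$; (H2) $\sum_{i=1}^r k_{ij}=0$ for every $j$; (H3) for all $i_0\ne i_1$ there are indices $j_1=i_0,j_2,\dots,j_l=i_1$ with $k_{j_mj_{m+1}}>0$ for $1\le m\le l-1$; (H4) $\lambda_i\ne\lambda_j$ for some $i,j$; (H5) $\lambda_i>0$ for every $i$. Let $U_0:[0,\infty)\to\mathbb R^r$ be continuous, and let $B:[0,\infty)\to\mathbb R^r$ be the steady solution with the same boundary value: $\Lambda B'(x)=KB(x)$ for $x\ge 0$ and $B(0)=U_0(0)$. Assume that $U_0-B\in H^2(0,\infty)$ and that $\Lambda U_0'(0)=KU_0(0)$ (where $U_0'(0)$ is the right derivative). Then $B$ is bounded, and the initial-boundary-value problem $$U_t+\Lambda U_x=KU\quad(x,t>0),\qquad U(x,0)=U_0(x)\ (x\ge 0),\qquad U(0,t)=U_0(0)\ (t\ge 0)$$ has a unique global solution $U$ with $U-B\in C([0,\infty);H^2(0,\infty))$,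 where a solution is a function that is continuous on $\{x,t\ge0\}$ and satisfies the equation pointwise for $x,t>0$. Moreover, $$\lim_{t\to\infty}\ \sup_{x\ge 0}|U(x,t)-B(x)|=0.$$ -/

import Mathlib

open Set Filter Topology MeasureTheory
open scoped ContDiff ENNReal

namespace AxonalTransport

/-- Lebesgue measure on the half-line `(0, ∞)`. -/
noncomputable def halfLine : Measure ℝ := volume.restrict (Ioi 0)

/-- `g` is the weak derivative of `f` on `(0, ∞)`, tested against `C_c^∞((0, ∞))`. It is only used
for `f` and `g` in `L²(0, ∞)`, where all the integrals converge. -/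
def IsWeakDeriv {E : Type*} [NormedAddCommGroup E] [NormedSpace ℝ E] (f g : ℝ → E) : Prop :=
  ∀ φ : ℝ → ℝ, ContDiff ℝ ∞ φ → HasCompactSupport φ → tsupport φ ⊆ Ioi 0 →
    ∫ x, deriv φ x • f x ∂halfLine = -∫ x, φ x • g x ∂halfLine

/-- `f`, `f' = g` and `f'' = h` (weak derivatives) all lie in `L²(0, ∞)`. -/
structure IsH2Jet {E : Type*} [NormedAddCommGroup E] [NormedSpace ℝ E] (f g h : ℝ → E) :
    Prop where
  memLp_zero : MemLp f 2 halfLine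
  memLp_one : MemLp g 2 halfLine
  memLp_two : MemLp h 2 halfLine
  deriv_one : IsWeakDeriv f g
  deriv_two : IsWeakDeriv g h

/-- `f ∈ H²(0, ∞)`. -/
def MemH2 {E : Type*} [NormedAddCommGroup E] [NormedSpace ℝ E] (f : ℝ → E) : Prop :=
  ∃ g h : ℝ → E, IsH2Jet f g h

/-- `t ↦ F t` belongs to `C([0, ∞); H²(0, ∞))`: every `F t` is in `H²`, and at every `t ≥ 0` the
`H²`-norm of `F s - F t` tends to `0` as `s → t`, `s ≥ 0`. Weak derivatives are unique almost
everywhere, so the choice of `F₁` and `F₂` does not matter. -/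
def ContinuousInH2 {E : Type*} [NormedAddCommGroup E] [NormedSpace ℝ E] (F : ℝ → ℝ → E) : Prop :=
  ∃ F₁ F₂ : ℝ → ℝ → E,
    (∀ t, 0 ≤ t → IsH2Jet (F t) (F₁ t) (F₂ t)) ∧
    ∀ t, 0 ≤ t →
      Tendsto (fun s => eLpNorm (F s - F t) 2 halfLine + eLpNorm (F₁ s - F₁ t) 2 halfLine
        + eLpNorm (F₂ s - F₂ t) 2 halfLine) (𝓝[Ici 0] t) (𝓝 0)

/-- `B` solves `Λ B' = K B` on `[0, ∞)`, where `Λ = diag(lam)`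
(the derivative at `0` is one-sided). -/
def IsSteadySolution {r : ℕ} (lam : Fin r → ℝ) (K : Matrix (Fin r) (Fin r) ℝ)
    (B : ℝ → EuclideanSpace ℝ (Fin r)) : Prop :=
  ∀ x, 0 ≤ x → ∃ d : EuclideanSpace ℝ (Fin r), HasDerivWithinAt B d (Ici 0) x ∧
    ∀ i, lam i * d i = ∑ j, K i j * B x j

/-- `Λ U₀'(0) = K U₀(0)`, with the right derivative at `0`. -/
def Compatible {r : ℕ} (lam : Fin r → ℝ) (K : Matrix (Fin r) (Fin r) ℝ)
    (U₀ : ℝ → EuclideanSpace ℝ (Fin r)) : Prop :=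
  ∃ d : EuclideanSpace ℝ (Fin r), HasDerivWithinAt U₀ d (Ici 0) 0 ∧
    ∀ i, lam i * d i = ∑ j, K i j * U₀ 0 j

/-- `U x t` is a classical solution on the quarter-plane `x, t ≥ 0` of `U_t + Λ U_x = K U`
with `U(x, 0) = U₀(x)` and `U(0, t) = U₀(0)`. -/
structure IsSolution {r : ℕ} (lam : Fin r → ℝ) (K : Matrix (Fin r) (Fin r) ℝ)
    (U₀ : ℝ → EuclideanSpace ℝ (Fin r)) (U : ℝ → ℝ → EuclideanSpace ℝ (Fin r)) : Prop where
  continuousOn : ContinuousOn (fun p : ℝ × ℝ => U p.1 p.2) (Ici 0 ×ˢ Ici 0)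
  equation : ∀ x t, 0 < x → 0 < t → ∃ Ut Ux : EuclideanSpace ℝ (Fin r),
    HasDerivAt (fun s => U x s) Ut t ∧ HasDerivAt (fun y => U y t) Ux x ∧
    ∀ i, Ut i + lam i * Ux i = ∑ j, K i j * U x t j
  initial : ∀ x, 0 ≤ x → U x 0 = U₀ x
  boundary : ∀ t, 0 ≤ t → U 0 t = U₀ 0

end AxonalTransport

open AxonalTransport

/-! The difference V = U - B solves the same system with zero boundary value and initial value v =
U₀ - B. The common boundary value gives v(0) = 0. Compatibility and the steady equation give U₀ and
B the same slope at 0, so v = o(x). This vanishing lets v be extended by zero to an H² function on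
the whole line (`isSchwartzWeakDeriv_indicator`), where the system is solved by Fourier transform
with propagator exp(t(K - 2πiξΛ)). Since all speeds are positive, nothing enters from the left: a
maximum principle keeps the solution zero on x ≤ 0 (`re_fourierSolution_eq_zero`), so its
restriction to x ≥ 0 meets the boundary condition. Uniqueness is the maximum principle on
rectangles.

For the decay, K has a positive null vector p, by a Perron-Frobenius argument. The energy ∑ |yᵢ|²/pᵢ
does not increase along the propagator: the transport part is skew for it, and K is dissipative.
Hence the propagator is bounded uniformly in t ≥ 0 and ξ. Constant energy forces y to stay parallel
to p, whereas for ξ ≠ 0 two components with different speeds rotate at different rates; so only y =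
0 keeps its energy, and a LaSalle argument gives decay at each ξ ≠ 0 (`tendsto_fourierFlow_atTop`).
The data have an integrable Fourier transform, so by dominated convergence the L¹ norm in ξ tends to
zero, and it bounds the supremum over x. The same dissipation, with x in the role of time, bounds B.
-/

open scoped FourierTransform SchwartzMap

/-! ### Maximum principles -/

/-- At a left-sided maximum the derivative is nonnegative. -/
theorem HasDerivAt.nonneg_of_le_left {f : ℝ → ℝ} {f' a t : ℝ} (hf : HasDerivAt f f' t)
    (hat : a < t) (hmax : ∀ s ∈ Icc a t, f s ≤ f t) : 0 ≤ f' := by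
  have h : Tendsto (slope f t) (𝓝[<] t) (𝓝 f') :=
    (hasDerivAt_iff_tendsto_slope.1 hf).mono_left
      (nhdsWithin_mono _ fun s (hs : s < t) => ne_of_lt hs)
  refine ge_of_tendsto h ?_
  filter_upwards [Ioo_mem_nhdsLT hat] with s hs
  rw [slope_def_field]
  exact div_nonneg_of_nonpos (sub_nonpos.2 (hmax s ⟨hs.1.le, hs.2.le⟩)) (sub_nonpos.2 hs.2.le)

/-- Maximum principle for weakly coupled transport systems with nonnegative speeds. -/
theorem transport_maximum_principle {r : ℕ} (lam : Fin r → ℝ) (K : Matrix (Fin r) (Fin r) ℝ)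
    (hK : ∀ i j, i ≠ j → 0 ≤ K i j) (hlam : ∀ i, 0 ≤ lam i) {a b T : ℝ}
    (W : ℝ → ℝ → Fin r → ℝ)
    (hcont : ∀ i, ContinuousOn (fun p : ℝ × ℝ => W p.1 p.2 i) (Icc a b ×ˢ Icc 0 T))
    (heq : ∀ x ∈ Ioc a b, ∀ t ∈ Ioc 0 T, ∀ i, ∃ wt wx : ℝ,
      HasDerivAt (fun s => W x s i) wt t ∧ HasDerivAt (fun y => W y t i) wx x ∧
        wt + lam i * wx ≤ ∑ j, K i j * W x t j)
    (hinit : ∀ x ∈ Icc a b, ∀ i, W x 0 i ≤ 0)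
    (hbdry : ∀ t ∈ Icc 0 T, ∀ i, W a t i ≤ 0) :
    ∀ x ∈ Icc a b, ∀ t ∈ Icc 0 T, ∀ i, W x t i ≤ 0 := by
  intro x₀ hx₀ t₀ ht₀ i₀
  -- The factor exp(-μt), with μ strictly above every row sum, makes the inequality at a positive
  -- maximum strict.
  obtain ⟨μ, hμ⟩ : ∃ μ : ℝ, ∀ i, ∑ j, K i j < μ := by
    refine ⟨∑ i, |∑ j, K i j| + 1, fun i => ?_⟩
    have := Finset.single_le_sum (f := fun i => |∑ j, K i j|) (fun i _ => abs_nonneg _)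
      (Finset.mem_univ i)
    have h2 := le_abs_self (∑ j, K i j)
    linarith
  let G : Fin r → ℝ × ℝ → ℝ := fun i p => Real.exp (-μ * p.2) * W p.1 p.2 i
  have hmax : ∀ i, ∃ p ∈ Icc a b ×ˢ Icc 0 T, IsMaxOn (G i) (Icc a b ×ˢ Icc 0 T) p := fun i =>
    (isCompact_Icc.prod isCompact_Icc).exists_isMaxOn ⟨(x₀, t₀), hx₀, ht₀⟩
      ((by fun_prop : Continuous fun p : ℝ × ℝ => Real.exp (-μ * p.2)).continuousOn.mul (hcont i))
  choose P hP hPmax using hmax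
  have : Nonempty (Fin r) := ⟨i₀⟩
  -- Maximizing over the component as well gives W_j ≤ W_i at the maximum point, which controls the
  -- coupling. Since the point may lie on the right or top edge, only comparison from the left is
  -- available; it yields μ W_i ≤ wt + lam i * wx ≤ (∑ j, K i j) W_i < μ W_i.
  obtain ⟨i, hi⟩ := Finite.exists_max fun i => G i (P i)
  have hG : ∀ j, ∀ p ∈ Icc a b ×ˢ Icc 0 T, G j p ≤ G i (P i) := fun j p hp =>
    (hPmax j hp).trans (hi j)
  by_contra hpos
  rw [not_le] at hpos
  have hGpos : 0 < G i (P i) :=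
    (mul_pos (Real.exp_pos _) hpos).trans_le (hG i₀ (x₀, t₀) ⟨hx₀, ht₀⟩)
  obtain ⟨⟨x, t⟩, hxt⟩ : ∃ p, P i = p := ⟨_, rfl⟩
  have hmem := hP i
  rw [hxt] at hmem hGpos hG
  obtain ⟨hx, ht⟩ := hmem
  simp only at hx ht
  have hWpos : 0 < W x t i := by
    by_contra h
    exact absurd hGpos (not_lt.2 (mul_nonpos_of_nonneg_of_nonpos (Real.exp_pos _).le (not_lt.1 h)))
  have hxa : a < x := lt_of_le_of_ne hx.1 fun h => by
    have := hbdry t ht i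
    rw [h] at this
    linarith
  have ht0 : 0 < t := lt_of_le_of_ne ht.1 fun h => by
    have := hinit x hx i
    rw [h] at this
    linarith
  obtain ⟨wt, wx, hwt, hwx, hle⟩ := heq x ⟨hxa, hx.2⟩ t ⟨ht0, ht.2⟩ i
  have hx' : 0 ≤ wx := by
    refine hwx.nonneg_of_le_left hxa fun y hy => ?_
    have := hG i (y, t) ⟨⟨hy.1, hy.2.trans hx.2⟩, ht⟩
    exact le_of_mul_le_mul_left this (Real.exp_pos _)
  have ht' : 0 ≤ wt - μ * W x t i := by
    have hd : HasDerivAt (fun s => Real.exp (-μ * s) * W x s i)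
        (Real.exp (-μ * t) * (-μ) * W x t i + Real.exp (-μ * t) * wt) t := by
      refine HasDerivAt.mul ?_ hwt
      simpa using ((hasDerivAt_id t).const_mul (-μ)).exp
    have h0 := hd.nonneg_of_le_left ht0 fun s hs => hG i (x, s) ⟨hx, hs.1, hs.2.trans ht.2⟩
    have h1 : 0 ≤ Real.exp (-μ * t) * (wt - μ * W x t i) := by linarith
    exact nonneg_of_mul_nonneg_right h1 (Real.exp_pos _)
  have hsum : ∑ j, K i j * W x t j ≤ (∑ j, K i j) * W x t i := by
    rw [Finset.sum_mul]
    refine Finset.sum_le_sum fun j _ => ?_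
    rcases eq_or_ne i j with rfl | hij
    · exact le_rfl
    · exact mul_le_mul_of_nonneg_left
        (le_of_mul_le_mul_left (hG j (x, t) ⟨hx, ht⟩) (Real.exp_pos _)) (hK i j hij)
  have h3 := mul_lt_mul_of_pos_right (hμ i) hWpos
  have h4 := mul_nonneg (hlam i) hx'
  linarith

/-- A bounded solution of the transport system on a left half-plane whose initial value vanishes
there is identically zero, since no information enters from `-∞`. -/
theorem transport_nonpos_of_bounded {r : ℕ} (lam : Fin r → ℝ) (K : Matrix (Fin r) (Fin r) ℝ)
    (hK : ∀ i j, i ≠ j → 0 ≤ K i j) (hlam : ∀ i, 0 ≤ lam i)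
    (W : ℝ → ℝ → Fin r → ℝ) {C : ℝ} (hC : ∀ x t i, 0 ≤ t → W x t i ≤ C)
    (hcont : ∀ i, ContinuousOn (fun p : ℝ × ℝ => W p.1 p.2 i) (univ ×ˢ Ici 0))
    (heq : ∀ x t, 0 < t → ∀ i, ∃ wt wx : ℝ,
      HasDerivAt (fun s => W x s i) wt t ∧ HasDerivAt (fun y => W y t i) wx x ∧
        wt + lam i * wx = ∑ j, K i j * W x t j)
    (hinit : ∀ x ≤ 0, ∀ i, W x 0 i ≤ 0) :
    ∀ x ≤ 0, ∀ t, 0 ≤ t → ∀ i, W x t i ≤ 0 := by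
  intro x₀ hx₀ t₀ ht₀ i₀
  obtain ⟨κ, hκ⟩ : ∃ κ : ℝ, 0 ≤ κ ∧ ∀ i, ∑ j, K i j ≤ κ := by
    refine ⟨∑ i, |∑ j, K i j|, by positivity, fun i => (le_abs_self _).trans ?_⟩
    exact Finset.single_le_sum (f := fun i => |∑ j, K i j|) (fun i _ => abs_nonneg _)
      (Finset.mem_univ i)
  obtain ⟨c, hc0, hc⟩ : ∃ c : ℝ, 0 ≤ c ∧ ∀ i, lam i ≤ c :=
    ⟨∑ i, lam i, Finset.sum_nonneg fun i _ => hlam i, fun i =>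
      Finset.single_le_sum (fun i _ => hlam i) (Finset.mem_univ i)⟩
  -- The barrier ε exp((κ + 1)t)(c - x) is a supersolution on x ≤ 0: there c - x ≥ lam i, so the
  -- extra 1 in the exponent pays for the transport term.
  have key : ∀ ε > 0, W x₀ t₀ i₀ ≤ ε * (Real.exp ((κ + 1) * t₀) * (c - x₀)) := by
    intro ε hε
    -- So far to the left the barrier exceeds the bound |C|, which supplies the missing boundary
    -- value.
    set a : ℝ := min x₀ (-(|C| / ε)) with ha
    have ha0 : a ≤ 0 := (min_le_left _ _).trans hx₀
    have := transport_maximum_principle lam K hK hlam (a := a) (b := 0) (T := t₀)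
      (fun x t i => W x t i - ε * (Real.exp ((κ + 1) * t) * (c - x))) ?_ ?_ ?_ ?_ x₀
      ⟨min_le_left _ _, hx₀⟩ t₀ ⟨ht₀, le_rfl⟩ i₀
    · linarith
    · intro i
      refine ((hcont i).mono ?_).sub (by fun_prop)
      exact prod_mono (subset_univ _) fun t ht => ht.1
    · intro x hx t ht i
      obtain ⟨wt, wx, hwt, hwx, h⟩ := heq x t ht.1 i
      refine ⟨wt - ε * (Real.exp ((κ + 1) * t) * (κ + 1) * (c - x)),
        wx - ε * (Real.exp ((κ + 1) * t) * (-1)), hwt.sub ?_, hwx.sub ?_, ?_⟩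
      · have : HasDerivAt (fun s : ℝ => Real.exp ((κ + 1) * s))
            (Real.exp ((κ + 1) * t) * (κ + 1)) t := by
          simpa using ((hasDerivAt_id t).const_mul (κ + 1)).exp
        exact (this.mul_const _).const_mul _
      · have : HasDerivAt (fun y : ℝ => c - y) (-1) x := by
          simpa using (hasDerivAt_id x).const_sub c
        exact (this.const_mul _).const_mul _
      · have hsum : ∑ j, K i j * (W x t j - ε * (Real.exp ((κ + 1) * t) * (c - x)))
            = ∑ j, K i j * W x t j - (∑ j, K i j) * (ε * (Real.exp ((κ + 1) * t) * (c - x))) := by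
          simp only [mul_sub, Finset.sum_sub_distrib, Finset.sum_mul]
        rw [hsum, ← h]
        have hcx : lam i ≤ c - x := by linarith [hc i, hx.2]
        have hcx0 : 0 ≤ c - x := (hlam i).trans hcx
        have h1 : (∑ j, K i j) * (c - x) ≤ κ * (c - x) :=
          mul_le_mul_of_nonneg_right (hκ.2 i) hcx0
        have h2 : 0 ≤ ε * Real.exp ((κ + 1) * t) := by positivity
        have h3 : 0 ≤ ε * Real.exp ((κ + 1) * t) *
            ((κ + 1) * (c - x) - lam i - (∑ j, K i j) * (c - x)) :=
          mul_nonneg h2 (by linarith)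
        linarith
    · intro x hx i
      have : 0 ≤ ε * (Real.exp ((κ + 1) * 0) * (c - x)) :=
        mul_nonneg hε.le (mul_nonneg (Real.exp_pos _).le (by linarith [hx.2]))
      linarith [hinit x hx.2 i]
    · intro t ht i
      have h1 : 1 ≤ Real.exp ((κ + 1) * t) := Real.one_le_exp (mul_nonneg (by linarith) ht.1)
      have h2 : |C| / ε ≤ c - a := by linarith [min_le_right x₀ (-(|C| / ε))]
      have h3 : |C| / ε ≤ Real.exp ((κ + 1) * t) * (c - a) :=
        h2.trans (le_mul_of_one_le_left (by linarith) h1)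
      have h4 : |C| ≤ ε * (Real.exp ((κ + 1) * t) * (c - a)) := by
        rw [div_le_iff₀ hε] at h3
        linarith
      linarith [hC a t i ht.1, le_abs_self C]
  have hlim : Tendsto (fun ε : ℝ => ε * (Real.exp ((κ + 1) * t₀) * (c - x₀))) (𝓝[>] 0) (𝓝 0) := by
    have : Tendsto (fun ε : ℝ => ε * (Real.exp ((κ + 1) * t₀) * (c - x₀))) (𝓝 0)
        (𝓝 (0 * (Real.exp ((κ + 1) * t₀) * (c - x₀)))) :=
      tendsto_id.mul tendsto_const_nhds
    rw [zero_mul] at this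
    exact this.mono_left nhdsWithin_le_nhds
  exact ge_of_tendsto hlim (eventually_mem_nhdsWithin.mono key)

/-! ### The positive null vector of K and its dissipation identity -/

section Kernel

variable {r : ℕ} {K : Matrix (Fin r) (Fin r) ℝ}

/-- A nonnegative-off-diagonal matrix with zero column sums which is irreducible has, among its
null vectors with a positive entry, only positive ones. -/
theorem pos_of_mulVec_eq_zero (hK : ∀ i j, i ≠ j → 0 ≤ K i j) (hsum : ∀ j, ∑ i, K i j = 0)
    (hirr : ∀ i j, i ≠ j → Relation.TransGen (fun i j => 0 < K i j) i j)
    {v : Fin r → ℝ} (hv : ∀ i, ∑ j, K i j * v j = 0) {i₀ : Fin r} (hi₀ : 0 < v i₀) :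
    ∀ i, 0 < v i := by
  classical
  set S : Finset (Fin r) := Finset.univ.filter fun i => 0 < v i with hS
  have hmem : ∀ i, i ∈ S ↔ 0 < v i := by simp [hS]
  have hcol : ∀ j ∈ S, ∑ i ∈ S, K i j = -∑ i ∈ Sᶜ, K i j := fun j _ => by
    have := Finset.sum_add_sum_compl S fun i => K i j
    rw [hsum] at this
    linarith
  -- Adding the rows in S of K v = 0 gives a sum of these terms. Each is nonpositive: for j in S the
  -- partial column sum is minus the sum over the complement, and for j outside S it is nonnegative
  -- while v j ≤ 0. So all vanish, and no edge leads from outside S into S.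
  have hterm : ∀ j, (∑ i ∈ S, K i j) * v j ≤ 0 := by
    intro j
    by_cases hj : j ∈ S
    · rw [hcol j hj]
      refine mul_nonpos_of_nonpos_of_nonneg (neg_nonpos.2 (Finset.sum_nonneg fun i hi => ?_))
        ((hmem j).1 hj).le
      exact hK i j fun h => (Finset.mem_compl.1 hi) (h ▸ hj)
    · refine mul_nonpos_of_nonneg_of_nonpos (Finset.sum_nonneg fun i hi => ?_)
        (not_lt.1 fun h => hj ((hmem j).2 h))
      exact hK i j fun h => hj (h ▸ hi)
  have htot : ∑ j, (∑ i ∈ S, K i j) * v j = 0 := by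
    simp_rw [Finset.sum_mul]
    rw [Finset.sum_comm]
    exact Finset.sum_eq_zero fun i _ => hv i
  have hzero : ∀ j, (∑ i ∈ S, K i j) * v j = 0 := fun j =>
    (Finset.sum_eq_zero_iff_of_nonpos fun j _ => hterm j).1 htot j (Finset.mem_univ j)
  have hedge : ∀ i j, 0 < K i j → j ∈ S → i ∈ S := by
    intro i j hij hj
    by_contra hi
    have h1 : ∑ i ∈ Sᶜ, K i j = 0 := by
      have := (mul_eq_zero.1 (hzero j)).resolve_right ((hmem j).1 hj).ne'
      rw [hcol j hj] at this
      linarith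
    have h2 := (Finset.sum_eq_zero_iff_of_nonneg (fun i' hi' =>
      hK i' j fun h => (Finset.mem_compl.1 hi') (h ▸ hj))).1 h1 i (Finset.mem_compl.2 hi)
    exact hij.ne' h2
  intro i
  rcases eq_or_ne i i₀ with rfl | h
  · exact hi₀
  · have hpath := hirr i i₀ h
    rw [← hmem]
    clear h
    induction hpath using Relation.TransGen.head_induction_on with
    | single h => exact hedge _ _ h ((hmem _).2 hi₀)
    | head h _ ih => exact hedge _ _ h ih

/-- Existence of a positive stationary vector. -/
theorem exists_pos_stationary [Nonempty (Fin r)]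
    (hK : ∀ i j, i ≠ j → 0 ≤ K i j) (hsum : ∀ j, ∑ i, K i j = 0)
    (hirr : ∀ i j, i ≠ j → Relation.TransGen (fun i j => 0 < K i j) i j) :
    ∃ w : Fin r → ℝ, (∀ i, 0 < w i) ∧ ∀ i, ∑ j, K i j * w j = 0 := by
  -- Zero column sums make the all-ones row vector a left null vector.
  have hdet : K.det = 0 := by
    refine Matrix.exists_vecMul_eq_zero_iff.1 ⟨1, one_ne_zero, ?_⟩
    ext j
    simpa [Matrix.vecMul, dotProduct] using hsum j
  obtain ⟨v, hv0, hv⟩ := Matrix.exists_mulVec_eq_zero_iff.2 hdet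
  have hv' : ∀ i, ∑ j, K i j * v j = 0 := fun i => congrFun hv i
  obtain ⟨i, hi⟩ := Function.ne_iff.1 hv0
  rcases lt_or_gt_of_ne hi with h | h
  · refine ⟨fun j => -v j, pos_of_mulVec_eq_zero hK hsum hirr ?_ (i₀ := i) (neg_pos.2 h), ?_⟩ <;>
    simp [hv']
  · exact ⟨v, pos_of_mulVec_eq_zero hK hsum hirr hv' h, hv'⟩

variable {w : Fin r → ℝ}

/-- The dissipation identity for the stationary vector `w`. -/
theorem sum_div_stationary_eq (hsum : ∀ j, ∑ i, K i j = 0) (hw : ∀ i, 0 < w i)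
    (hKw : ∀ i, ∑ j, K i j * w j = 0) (y : Fin r → ℝ) :
    2 * ∑ i, y i * (∑ j, K i j * y j) / w i =
      -∑ i, ∑ j, K i j * w j * (y i / w i - y j / w j) ^ 2 := by
  -- When the square is expanded, one pure square vanishes because K w = 0, the other because
  -- columns sum to zero; only the cross term remains.
  have h1 : ∑ i, ∑ j, K i j * w j * (y i / w i) ^ 2 = 0 := by
    refine Finset.sum_eq_zero fun i _ => ?_
    rw [← Finset.sum_mul, hKw, zero_mul]
  have h2 : ∑ i, ∑ j, K i j * w j * (y j / w j) ^ 2 = 0 := by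
    rw [Finset.sum_comm]
    refine Finset.sum_eq_zero fun j _ => ?_
    simp_rw [mul_assoc]
    rw [← Finset.sum_mul, hsum, zero_mul]
  have h3 : ∑ i, y i * (∑ j, K i j * y j) / w i =
      ∑ i, ∑ j, K i j * w j * ((y i / w i) * (y j / w j)) := by
    refine Finset.sum_congr rfl fun i _ => ?_
    rw [Finset.mul_sum, Finset.sum_div]
    refine Finset.sum_congr rfl fun j _ => ?_
    have := (hw i).ne'
    have := (hw j).ne'
    field_simp
  have h4 : ∑ i, ∑ j, K i j * w j * (y i / w i - y j / w j) ^ 2 =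
      ∑ i, ∑ j, K i j * w j * (y i / w i) ^ 2 + ∑ i, ∑ j, K i j * w j * (y j / w j) ^ 2
        - 2 * ∑ i, ∑ j, K i j * w j * ((y i / w i) * (y j / w j)) := by
    simp only [Finset.mul_sum, ← Finset.sum_add_distrib, ← Finset.sum_sub_distrib]
    refine Finset.sum_congr rfl fun i _ => Finset.sum_congr rfl fun j _ => ?_
    ring
  rw [h4, h1, h2, h3]
  ring

theorem dissipation_term_nonneg (hK : ∀ i j, i ≠ j → 0 ≤ K i j) (hw : ∀ i, 0 < w i)
    (y : Fin r → ℝ) (i j : Fin r) : 0 ≤ K i j * w j * (y i / w i - y j / w j) ^ 2 := by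
  rcases eq_or_ne i j with rfl | h
  · simp
  · exact mul_nonneg (mul_nonneg (hK i j h) (hw j).le) (sq_nonneg _)

theorem sum_div_stationary_nonpos (hK : ∀ i j, i ≠ j → 0 ≤ K i j)
    (hsum : ∀ j, ∑ i, K i j = 0) (hw : ∀ i, 0 < w i)
    (hKw : ∀ i, ∑ j, K i j * w j = 0) (y : Fin r → ℝ) :
    ∑ i, y i * (∑ j, K i j * y j) / w i ≤ 0 := by
  have h := sum_div_stationary_eq hsum hw hKw y
  have : 0 ≤ ∑ i, ∑ j, K i j * w j * (y i / w i - y j / w j) ^ 2 :=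
    Finset.sum_nonneg fun i _ => Finset.sum_nonneg fun j _ => dissipation_term_nonneg hK hw y i j
  linarith

/-- Vanishing dissipation forces proportionality to the stationary vector. -/
theorem div_stationary_eq_of_sum_eq_zero (hK : ∀ i j, i ≠ j → 0 ≤ K i j)
    (hsum : ∀ j, ∑ i, K i j = 0)
    (hirr : ∀ i j, i ≠ j → Relation.TransGen (fun i j => 0 < K i j) i j) (hw : ∀ i, 0 < w i)
    (hKw : ∀ i, ∑ j, K i j * w j = 0) {y : Fin r → ℝ}
    (hy : ∑ i, y i * (∑ j, K i j * y j) / w i = 0) (i j : Fin r) : y i / w i = y j / w j := by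
  have h := sum_div_stationary_eq hsum hw hKw y
  rw [hy, mul_zero, eq_comm, neg_eq_zero] at h
  have hterm : ∀ i j, K i j * w j * (y i / w i - y j / w j) ^ 2 = 0 := fun i j => by
    have h1 := (Finset.sum_eq_zero_iff_of_nonneg fun i _ =>
      Finset.sum_nonneg fun j _ => dissipation_term_nonneg hK hw y i j).1 h i (Finset.mem_univ i)
    exact (Finset.sum_eq_zero_iff_of_nonneg fun j _ => dissipation_term_nonneg hK hw y i j).1 h1 j
      (Finset.mem_univ j)
  have hedge : ∀ i j, 0 < K i j → y i / w i = y j / w j := fun i j hij => by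
    have := (mul_eq_zero.1 (hterm i j)).resolve_left (mul_pos hij (hw j)).ne'
    exact sub_eq_zero.1 (pow_eq_zero_iff two_ne_zero |>.1 this)
  rcases eq_or_ne i j with rfl | hne
  · rfl
  · have := hirr i j hne
    clear hne
    induction this with
    | single h => exact hedge _ _ h
    | tail _ h ih => exact ih.trans (hedge _ _ h)

end Kernel

/-- Steady solutions are bounded. -/
theorem AxonalTransport.IsSteadySolution.bounded {r : ℕ} {lam : Fin r → ℝ}
    {K : Matrix (Fin r) (Fin r) ℝ} (hK : ∀ i j, i ≠ j → 0 ≤ K i j)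
    (hsum : ∀ j, ∑ i, K i j = 0) (hlam : ∀ i, 0 < lam i) {w : Fin r → ℝ} (hw : ∀ i, 0 < w i)
    (hKw : ∀ i, ∑ j, K i j * w j = 0) {B : ℝ → EuclideanSpace ℝ (Fin r)}
    (hB : IsSteadySolution lam K B) : ∃ C : ℝ, ∀ x, 0 ≤ x → ‖B x‖ ≤ C := by
  -- The energy flux: Λ B' = K B turns its derivative into 2 ∑ Bᵢ (K B)ᵢ / wᵢ ≤ 0.
  let Q : ℝ → ℝ := fun x => ∑ i, lam i / w i * (B x i) ^ 2
  have hcoord : ∀ {x : ℝ} {d : EuclideanSpace ℝ (Fin r)} {s : Set ℝ}, HasDerivWithinAt B d s x →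
      ∀ i, HasDerivWithinAt (fun y => B y i) (d i) s x := fun hd i =>
    ((EuclideanSpace.proj i : EuclideanSpace ℝ (Fin r) →L[ℝ] ℝ).hasFDerivAt.comp_hasDerivWithinAt
      _ hd)
  have hcont : ContinuousOn Q (Ici 0) := by
    have hBc : ∀ i, ContinuousOn (fun y => B y i) (Ici 0) := fun i x hx => by
      obtain ⟨d, hd, -⟩ := hB x hx
      exact (hcoord hd i).continuousWithinAt
    exact continuousOn_finsetSum _ fun i _ => continuousOn_const.mul ((hBc i).pow 2)
  have hderiv : ∀ x ∈ Ioi (0 : ℝ), ∃ q ≤ 0, HasDerivAt Q q x := by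
    intro x hx
    obtain ⟨d, hd, he⟩ := hB x (le_of_lt hx)
    refine ⟨∑ i, lam i / w i * (2 * B x i * d i), ?_, ?_⟩
    · have h := sum_div_stationary_nonpos hK hsum hw hKw (fun i => B x i)
      have h2 : ∑ i, lam i / w i * (2 * B x i * d i) =
          2 * ∑ i, B x i * (∑ j, K i j * B x j) / w i := by
        rw [Finset.mul_sum]
        refine Finset.sum_congr rfl fun i _ => ?_
        rw [← he i]
        ring
      linarith
    · refine HasDerivAt.fun_sum fun i _ => HasDerivAt.const_mul _ ?_
      have := (hcoord hd i).hasDerivAt (Ici_mem_nhds hx)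
      simpa using this.fun_pow 2
  have hanti : AntitoneOn Q (Ici 0) := by
    refine antitoneOn_of_deriv_nonpos (convex_Ici 0) hcont ?_ ?_
    · rw [interior_Ici]
      intro x hx
      obtain ⟨q, -, hq⟩ := hderiv x hx
      exact hq.differentiableAt.differentiableWithinAt
    · rw [interior_Ici]
      intro x hx
      obtain ⟨q, h0, hq⟩ := hderiv x hx
      rw [hq.deriv]
      exact h0
  refine ⟨∑ i, √(w i / lam i * Q 0), fun x hx => ?_⟩
  have hpos : ∀ i, 0 < lam i / w i := fun i => div_pos (hlam i) (hw i)
  have hi : ∀ i, |B x i| ≤ √(w i / lam i * Q 0) := fun i => by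
    refine Real.abs_le_sqrt ?_
    have h1 : lam i / w i * (B x i) ^ 2 ≤ Q x :=
      Finset.single_le_sum (f := fun i => lam i / w i * (B x i) ^ 2)
        (fun i _ => mul_nonneg (hpos i).le (sq_nonneg _)) (Finset.mem_univ i)
    have h2 : Q x ≤ Q 0 := hanti self_mem_Ici hx hx
    have h3 : w i / lam i * (lam i / w i * (B x i) ^ 2) ≤ w i / lam i * Q 0 :=
      mul_le_mul_of_nonneg_left (h1.trans h2) (div_pos (hw i) (hlam i)).le
    have h4 : w i / lam i * (lam i / w i * (B x i) ^ 2) = (B x i) ^ 2 := by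
      have := (hw i).ne'
      have := (hlam i).ne'
      field_simp
    linarith
  calc ‖B x‖ ≤ ∑ i, ‖B x i‖ := by
        rw [EuclideanSpace.norm_eq]
        refine (Real.sqrt_le_sqrt (Finset.sum_sq_le_sq_sum_of_nonneg
          fun i _ => norm_nonneg _)).trans ?_
        rw [Real.sqrt_sq (Finset.sum_nonneg fun i _ => norm_nonneg _)]
    _ ≤ _ := Finset.sum_le_sum fun i _ => hi i

/-! ### The Fourier propagator -/

/-- The propagator `exp (t (K - 2πiξ L))` of the Fourier-transformed transport equation. -/
noncomputable def fourierFlow {E : Type*} [NormedAddCommGroup E] [NormedSpace ℂ E]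
    (K L : E →L[ℂ] E) (t ξ : ℝ) : E →L[ℂ] E :=
  NormedSpace.exp (t • (K - (2 * Real.pi * ξ * Complex.I : ℂ) • L))

@[simp] theorem fourierFlow_zero {E : Type*} [NormedAddCommGroup E] [NormedSpace ℂ E]
    (K L : E →L[ℂ] E) (ξ : ℝ) : fourierFlow K L 0 ξ = 1 := by
  simp [fourierFlow]

section Flow

variable {E : Type*} [NormedAddCommGroup E] [NormedSpace ℂ E] [CompleteSpace E] (K L : E →L[ℂ] E)

theorem continuous_fourierFlow : Continuous fun p : ℝ × ℝ => fourierFlow K L p.1 p.2 := by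
  unfold fourierFlow
  let : NormedAlgebra ℚ (E →L[ℂ] E) := NormedAlgebra.restrictScalars ℚ ℂ _
  exact NormedSpace.exp_continuous.comp (by fun_prop)

theorem hasDerivAt_fourierFlow (t ξ : ℝ) :
    HasDerivAt (fun s => fourierFlow K L s ξ)
      ((K - (2 * Real.pi * ξ * Complex.I : ℂ) • L) * fourierFlow K L t ξ) t := by
  exact hasDerivAt_exp_smul_const' (𝕂 := ℝ) (K - (2 * Real.pi * ξ * Complex.I : ℂ) • L) t

theorem hasDerivAt_fourierFlow_apply (t ξ : ℝ) (y : E) :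
    HasDerivAt (fun s => fourierFlow K L s ξ y)
      (K (fourierFlow K L t ξ y) - (2 * Real.pi * ξ * Complex.I : ℂ) • L (fourierFlow K L t ξ y))
      t := by
  exact (((ContinuousLinearMap.apply ℂ E y).restrictScalars ℝ).hasFDerivAt.comp_hasDerivAt t
    (hasDerivAt_fourierFlow K L t ξ) :)

/-- The real factor is collected into one cast, so that `hasDerivAt_weightedEnergy` applies with κ =
2πξ. -/
theorem hasDerivAt_fourierFlow_apply' (t ξ : ℝ) (y : E) :
    HasDerivAt (fun s => fourierFlow K L s ξ y)
      (K (fourierFlow K L t ξ y) -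
        ((2 * Real.pi * ξ : ℝ) * Complex.I : ℂ) • L (fourierFlow K L t ξ y)) t := by
  simpa using hasDerivAt_fourierFlow_apply K L t ξ y

theorem fourierFlow_add (s t ξ : ℝ) :
    fourierFlow K L (s + t) ξ = fourierFlow K L s ξ * fourierFlow K L t ξ := by
  let : NormedAlgebra ℚ (E →L[ℂ] E) := NormedAlgebra.restrictScalars ℚ ℂ _
  unfold fourierFlow
  rw [add_smul]
  exact NormedSpace.exp_add_of_commute (((Commute.refl _).smul_left _).smul_right _)

end Flow

/-! ### The weighted energy -/

section Energy

variable {r : ℕ}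

/-- The quadratic form weighted by the reciprocals of `w`. -/
noncomputable def weightedEnergy (w : Fin r → ℝ) (y : EuclideanSpace ℂ (Fin r)) : ℝ :=
  ∑ i, ((y i).re ^ 2 + (y i).im ^ 2) / w i

/-- A real matrix acting on complex vectors. -/
noncomputable def complexOp (K : Matrix (Fin r) (Fin r) ℝ) :
    EuclideanSpace ℂ (Fin r) →L[ℂ] EuclideanSpace ℂ (Fin r) :=
  Matrix.toEuclideanCLM (𝕜 := ℂ) (K.map Complex.ofReal)

theorem complexOp_apply (K : Matrix (Fin r) (Fin r) ℝ) (y : EuclideanSpace ℂ (Fin r)) (i : Fin r) :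
    complexOp K y i = ∑ j, (K i j : ℂ) * y j := by
  simp [complexOp, Matrix.ofLp_toEuclideanCLM, Matrix.mulVec, dotProduct]

theorem complexOp_diagonal_apply (lam : Fin r → ℝ) (y : EuclideanSpace ℂ (Fin r)) (i : Fin r) :
    complexOp (Matrix.diagonal lam) y i = (lam i : ℂ) * y i := by
  rw [complexOp_apply, Finset.sum_eq_single i]
  · simp
  · intro j _ hj
    simp [Matrix.diagonal_apply_ne _ hj.symm]
  · simp

theorem continuous_weightedEnergy (w : Fin r → ℝ) : Continuous (weightedEnergy w) := by
  unfold weightedEnergy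
  fun_prop

variable {K : Matrix (Fin r) (Fin r) ℝ} {lam w : Fin r → ℝ}

theorem weightedEnergy_nonneg (hw : ∀ i, 0 < w i) (y : EuclideanSpace ℂ (Fin r)) :
    0 ≤ weightedEnergy w y :=
  Finset.sum_nonneg fun i _ => div_nonneg (by positivity) (hw i).le

theorem exists_weightedEnergy_le (hw : ∀ i, 0 < w i) :
    ∃ C : ℝ, 0 ≤ C ∧ ∀ y, weightedEnergy w y ≤ C * ‖y‖ ^ 2 := by
  refine ⟨∑ i, 1 / w i, Finset.sum_nonneg fun i _ => (div_pos one_pos (hw i)).le, fun y => ?_⟩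
  rw [Finset.sum_mul]
  refine Finset.sum_le_sum fun i _ => ?_
  have h : (y i).re ^ 2 + (y i).im ^ 2 ≤ ‖y‖ ^ 2 := by
    have h1 : ‖y i‖ ≤ ‖y‖ := PiLp.norm_apply_le y i
    have h2 : ‖y i‖ ^ 2 = (y i).re ^ 2 + (y i).im ^ 2 := by
      rw [Complex.sq_norm, Complex.normSq_apply]; ring
    rw [← h2]
    gcongr
  rw [one_div, ← div_eq_inv_mul]
  exact div_le_div_of_nonneg_right h (hw i).le

theorem exists_norm_sq_le_weightedEnergy (hw : ∀ i, 0 < w i) :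
    ∃ C : ℝ, 0 ≤ C ∧ ∀ y, ‖y‖ ^ 2 ≤ C * weightedEnergy w y := by
  refine ⟨∑ i, w i, Finset.sum_nonneg fun i _ => (hw i).le, fun y => ?_⟩
  rw [EuclideanSpace.norm_sq_eq, weightedEnergy, Finset.mul_sum]
  refine Finset.sum_le_sum fun i _ => ?_
  rw [Complex.sq_norm, Complex.normSq_apply, ← mul_div_assoc, le_div_iff₀ (hw i), mul_comm, ← sq,
    ← sq]
  exact mul_le_mul_of_nonneg_right
    (Finset.single_le_sum (fun i _ => (hw i).le) (Finset.mem_univ i)) (by positivity)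

/-- Energy production along `y' = (K - iκ diag lam) y`; the transport part drops out. -/
theorem hasDerivAt_weightedEnergy {y : ℝ → EuclideanSpace ℂ (Fin r)} {κ t : ℝ}
    (hy : HasDerivAt y (complexOp K (y t) -
      (κ * Complex.I : ℂ) • complexOp (Matrix.diagonal lam) (y t)) t) :
    HasDerivAt (fun s => weightedEnergy w (y s))
      (2 * ((∑ i, (y t i).re * (∑ j, K i j * (y t j).re) / w i) +
        ∑ i, (y t i).im * (∑ j, K i j * (y t j).im) / w i)) t := by
  have hcoord : ∀ i, HasDerivAt (fun s => y s i) ((∑ j, (K i j : ℂ) * y t j) -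
      (κ * Complex.I : ℂ) * ((lam i : ℂ) * y t i)) t := fun i => by
    have := (((EuclideanSpace.proj i : EuclideanSpace ℂ (Fin r) →L[ℂ] ℂ).restrictScalars
      ℝ).hasFDerivAt.comp_hasDerivAt t hy)
    convert! this using 1
    change _ = (complexOp K (y t) - (κ * Complex.I : ℂ) • complexOp (Matrix.diagonal lam) (y t)) i
    rw [PiLp.sub_apply, PiLp.smul_apply, complexOp_diagonal_apply, complexOp_apply, smul_eq_mul]
  -- The transport part rotates each coordinate: its contributions to the derivatives of re and im
  -- cancel in re² + im².
  have hre : ∀ i, HasDerivAt (fun s => (y s i).re)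
      ((∑ j, K i j * (y t j).re) + κ * lam i * (y t i).im) t := fun i => by
    have := (Complex.reCLM.hasFDerivAt.comp_hasDerivAt t (hcoord i))
    convert! this using 1
    simp
    ring
  have him : ∀ i, HasDerivAt (fun s => (y s i).im)
      ((∑ j, K i j * (y t j).im) - κ * lam i * (y t i).re) t := fun i => by
    have := (Complex.imCLM.hasFDerivAt.comp_hasDerivAt t (hcoord i))
    convert! this using 1
    simp
    ring
  have := HasDerivAt.fun_sum (u := Finset.univ) fun i _ =>
    (((hre i).fun_pow 2).add ((him i).fun_pow 2)).div_const (w i)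
  convert! this using 1
  rw [← Finset.sum_add_distrib, Finset.mul_sum]
  refine Finset.sum_congr rfl fun i _ => ?_
  push_cast
  ring

end Energy

/-! ### Uniform bounds and decay at nonzero frequencies -/

section Decay

variable {r : ℕ} {K : Matrix (Fin r) (Fin r) ℝ} {lam w : Fin r → ℝ}

theorem antitone_weightedEnergy_fourierFlow (hK : ∀ i j, i ≠ j → 0 ≤ K i j)
    (hsum : ∀ j, ∑ i, K i j = 0) (hw : ∀ i, 0 < w i) (hKw : ∀ i, ∑ j, K i j * w j = 0)
    (ξ : ℝ) (y : EuclideanSpace ℂ (Fin r)) :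
    Antitone fun t => weightedEnergy w
      (fourierFlow (complexOp K) (complexOp (Matrix.diagonal lam)) t ξ y) := by
  have hd := fun t => hasDerivAt_weightedEnergy (w := w)
    (hasDerivAt_fourierFlow_apply' (complexOp K) (complexOp (Matrix.diagonal lam)) t ξ y)
  refine antitone_of_deriv_nonpos (fun t => (hd t).differentiableAt) fun t => ?_
  rw [(hd t).deriv]
  have h1 := sum_div_stationary_nonpos hK hsum hw hKw
    fun i => (fourierFlow (complexOp K) (complexOp (Matrix.diagonal lam)) t ξ y i).re
  have h2 := sum_div_stationary_nonpos hK hsum hw hKw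
    fun i => (fourierFlow (complexOp K) (complexOp (Matrix.diagonal lam)) t ξ y i).im
  linarith

/-- The energy is equivalent to the squared norm with constants that do not involve ξ. The resulting
C is the constant of all later dominations. -/
theorem exists_norm_fourierFlow_le (hK : ∀ i j, i ≠ j → 0 ≤ K i j)
    (hsum : ∀ j, ∑ i, K i j = 0) (hw : ∀ i, 0 < w i) (hKw : ∀ i, ∑ j, K i j * w j = 0) :
    ∃ C : ℝ, ∀ t ξ, 0 ≤ t →
      ‖fourierFlow (complexOp K) (complexOp (Matrix.diagonal lam)) t ξ‖ ≤ C := by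
  obtain ⟨C₁, hC₁, h₁⟩ := exists_weightedEnergy_le hw
  obtain ⟨C₂, hC₂, h₂⟩ := exists_norm_sq_le_weightedEnergy hw
  refine ⟨√(C₂ * C₁), fun t ξ ht => ContinuousLinearMap.opNorm_le_bound _ (Real.sqrt_nonneg _)
    fun y => ?_⟩
  have h := antitone_weightedEnergy_fourierFlow (lam := lam) hK hsum hw hKw ξ y ht
  simp only [fourierFlow_zero, one_apply_eq_self] at h
  refine le_of_sq_le_sq ?_ (by positivity)
  rw [mul_pow, Real.sq_sqrt (by positivity), mul_assoc]
  exact (h₂ _).trans (mul_le_mul_of_nonneg_left (h.trans (h₁ y)) hC₂)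

/-- If the energy does not decrease over a unit time, the state is zero. -/
theorem eq_zero_of_weightedEnergy_fourierFlow_eq (hK : ∀ i j, i ≠ j → 0 ≤ K i j)
    (hsum : ∀ j, ∑ i, K i j = 0)
    (hirr : ∀ i j, i ≠ j → Relation.TransGen (fun i j => 0 < K i j) i j) (hw : ∀ i, 0 < w i)
    (hKw : ∀ i, ∑ j, K i j * w j = 0) (hlam : ∃ i j, lam i ≠ lam j) {ξ : ℝ} (hξ : ξ ≠ 0)
    {y : EuclideanSpace ℂ (Fin r)}
    (hy : weightedEnergy w (fourierFlow (complexOp K) (complexOp (Matrix.diagonal lam)) 1 ξ y) =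
      weightedEnergy w y) : y = 0 := by
  set z : ℝ → EuclideanSpace ℂ (Fin r) := fun t =>
    fourierFlow (complexOp K) (complexOp (Matrix.diagonal lam)) t ξ y with hz
  have hzd : ∀ t, HasDerivAt z (complexOp K (z t) -
      ((2 * Real.pi * ξ : ℝ) * Complex.I : ℂ) • complexOp (Matrix.diagonal lam) (z t)) t :=
    fun t => hasDerivAt_fourierFlow_apply' (complexOp K) (complexOp (Matrix.diagonal lam)) t ξ y
  have hz0 : z 0 = y := by simp [hz]
  have hanti : Antitone fun t => weightedEnergy w (z t) :=
    antitone_weightedEnergy_fourierFlow hK hsum hw hKw ξ y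
  have hconst : ∀ t ∈ Icc (0 : ℝ) 1, weightedEnergy w (z t) = weightedEnergy w y := fun t ht => by
    refine le_antisymm ?_ ?_
    · have := hanti ht.1
      simpa only [hz0] using this
    · rw [← hy]
      exact hanti ht.2
  -- Constant energy means zero dissipation. Real and imaginary parts each contribute a nonpositive
  -- amount, so both vanish and z(t) is proportional to w.
  have hprop : ∀ t ∈ Ioo (0 : ℝ) 1, ∀ i j, z t i / w i = z t j / w j := by
    intro t ht i j
    have h1 := hasDerivAt_weightedEnergy (w := w) (hzd t)
    have h2 : HasDerivAt (fun s => weightedEnergy w (z s)) 0 t :=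
      (hasDerivAt_const t (weightedEnergy w y)).congr_of_eventuallyEq (by
        filter_upwards [Ioo_mem_nhds ht.1 ht.2] with s hs using hconst s ⟨hs.1.le, hs.2.le⟩)
    have h3 := h1.unique h2
    have hre := sum_div_stationary_nonpos hK hsum hw hKw fun i => (z t i).re
    have him := sum_div_stationary_nonpos hK hsum hw hKw fun i => (z t i).im
    have hre' := div_stationary_eq_of_sum_eq_zero hK hsum hirr hw hKw (y := fun i => (z t i).re)
      (by linarith) i j
    have him' := div_stationary_eq_of_sum_eq_zero hK hsum hirr hw hKw (y := fun i => (z t i).im)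
      (by linarith) i j
    apply Complex.ext
    · simpa using hre'
    · simpa using him'
  obtain ⟨i, j, hij⟩ := hlam
  have h12 : (1 / 2 : ℝ) ∈ Ioo (0 : ℝ) 1 := by norm_num
  have hKz : ∀ k, ∑ l, (K k l : ℂ) * z (1 / 2) l = 0 := fun k => by
    have h1 : ∀ l, z (1 / 2) l = z (1 / 2) i / w i * w l := fun l => by
      rw [hprop _ h12 i l, div_mul_cancel₀]
      exact Complex.ofReal_ne_zero.2 (hw l).ne'
    calc ∑ l, (K k l : ℂ) * z (1 / 2) l
        = ∑ l, z (1 / 2) i / w i * ((K k l * w l : ℝ) : ℂ) :=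
          Finset.sum_congr rfl fun l _ => by rw [h1 l]; push_cast; ring
      _ = 0 := by rw [← Finset.mul_sum, ← Complex.ofReal_sum, hKw]; simp
  -- Since z(1/2) is proportional to w, K z(1/2) = 0 and only rotation is left. The ratios z_k / w_k
  -- agree for all k near 1/2, hence so do their derivatives, and lam i ≠ lam j forces the common
  -- ratio to be zero.
  have hcoord : ∀ k, HasDerivAt (fun s => z s k / w k)
      (-(((2 * Real.pi * ξ : ℝ) * Complex.I : ℂ) * ((lam k : ℂ) * z (1 / 2) k)) / w k)
      (1 / 2) := fun k => by
    have := (((EuclideanSpace.proj k : EuclideanSpace ℂ (Fin r) →L[ℂ] ℂ).restrictScalars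
      ℝ).hasFDerivAt.comp_hasDerivAt _ (hzd (1 / 2)))
    have h2 : HasDerivAt (fun s => z s k)
        (-(((2 * Real.pi * ξ : ℝ) * Complex.I : ℂ) * ((lam k : ℂ) * z (1 / 2) k))) (1 / 2) := by
      convert! this using 1
      change _ = (complexOp K (z (1 / 2)) - ((2 * Real.pi * ξ : ℝ) * Complex.I : ℂ) •
        complexOp (Matrix.diagonal lam) (z (1 / 2))) k
      rw [PiLp.sub_apply, PiLp.smul_apply, complexOp_diagonal_apply, complexOp_apply, smul_eq_mul,
        hKz, zero_sub]
    exact h2.div_const _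
  have heq := (hcoord i).unique ((hcoord j).congr_of_eventuallyEq (by
    filter_upwards [Ioo_mem_nhds h12.1 h12.2] with s hs using hprop s hs i j))
  have hq : ∀ k, z (1 / 2) k / w k = z (1 / 2) i / w i := fun k => hprop _ h12 k i
  have hzero : z (1 / 2) i / w i = 0 := by
    have h1 : ((2 * Real.pi * ξ : ℝ) * Complex.I : ℂ) * ((lam i : ℂ) - lam j) *
        (z (1 / 2) i / w i) = 0 := by
      have h2 := hq j
      calc ((2 * Real.pi * ξ : ℝ) * Complex.I : ℂ) * ((lam i : ℂ) - lam j) * (z (1 / 2) i / w i)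
          = ((2 * Real.pi * ξ : ℝ) * Complex.I : ℂ) * lam i * (z (1 / 2) i / w i) -
            ((2 * Real.pi * ξ : ℝ) * Complex.I : ℂ) * lam j * (z (1 / 2) j / w j) := by
              rw [h2]; ring
        _ = 0 := by linear_combination -heq
    refine (mul_eq_zero.1 h1).resolve_left (mul_ne_zero (mul_ne_zero ?_ Complex.I_ne_zero) ?_)
    · exact_mod_cast mul_ne_zero (mul_ne_zero two_ne_zero Real.pi_ne_zero) hξ
    · exact sub_ne_zero.2 (by exact_mod_cast hij)
  have hhalf : z (1 / 2) = 0 := by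
    ext k
    have h1 := hq k
    rw [hzero] at h1
    exact (div_eq_zero_iff.1 h1).resolve_right (Complex.ofReal_ne_zero.2 (hw k).ne')
  have h0 : weightedEnergy w y = 0 := by
    rw [← hconst _ ⟨h12.1.le, h12.2.le⟩, hhalf]
    simp [weightedEnergy]
  obtain ⟨C, -, hC⟩ := exists_norm_sq_le_weightedEnergy hw
  have := hC y
  rw [h0, mul_zero] at this
  exact norm_eq_zero.1 (pow_eq_zero_iff two_ne_zero |>.1 (le_antisymm this (sq_nonneg _)))

/-- At every nonzero frequency the propagator tends to zero strongly. -/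
theorem tendsto_fourierFlow_atTop (hK : ∀ i j, i ≠ j → 0 ≤ K i j)
    (hsum : ∀ j, ∑ i, K i j = 0)
    (hirr : ∀ i j, i ≠ j → Relation.TransGen (fun i j => 0 < K i j) i j) (hw : ∀ i, 0 < w i)
    (hKw : ∀ i, ∑ j, K i j * w j = 0) (hlam : ∃ i j, lam i ≠ lam j) {ξ : ℝ} (hξ : ξ ≠ 0)
    (y : EuclideanSpace ℂ (Fin r)) :
    Tendsto (fun t => fourierFlow (complexOp K) (complexOp (Matrix.diagonal lam)) t ξ y) atTop
      (𝓝 0) := by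
  set S := fun t => fourierFlow (complexOp K) (complexOp (Matrix.diagonal lam)) t ξ with hS
  have hanti : Antitone fun t => weightedEnergy w (S t y) :=
    antitone_weightedEnergy_fourierFlow hK hsum hw hKw ξ y
  obtain ⟨C, hC⟩ := exists_norm_fourierFlow_le (lam := lam) hK hsum hw hKw
  obtain ⟨C₂, hC₂, h₂⟩ := exists_norm_sq_le_weightedEnergy hw
  have hlim := tendsto_atTop_ciInf hanti ⟨0, by
    rintro _ ⟨t, rfl⟩
    exact weightedEnergy_nonneg hw _⟩
  set l := ⨅ t, weightedEnergy w (S t y)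
  have hbdd : ∀ n : ℕ, S n y ∈ Metric.closedBall (0 : EuclideanSpace ℂ (Fin r)) (C * ‖y‖) :=
    fun n => by
      rw [mem_closedBall_zero_iff]
      exact (S n).le_of_opNorm_le (hC n ξ n.cast_nonneg) y
  -- LaSalle: the orbit is bounded in finite dimension, so it has a limit point a along integer
  -- times. Both a and its image after unit time have the limiting energy l, hence a = 0 and l = 0.
  obtain ⟨a, -, φ, hφ, ha⟩ := tendsto_subseq_of_bounded Metric.isBounded_closedBall hbdd
  have hnat : Tendsto (fun n => ((φ n : ℕ) : ℝ)) atTop atTop :=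
    tendsto_natCast_atTop_atTop.comp hφ.tendsto_atTop
  have e1 : weightedEnergy w a = l :=
    tendsto_nhds_unique (((continuous_weightedEnergy w).tendsto a).comp ha) (hlim.comp hnat)
  have e2 : weightedEnergy w (S 1 a) = l := by
    refine tendsto_nhds_unique ((((continuous_weightedEnergy w).comp (S 1).continuous).tendsto
      a).comp ha) ((hlim.comp (tendsto_atTop_add_const_left _ (1 : ℝ) hnat)).congr fun n => ?_)
    simp [hS, fourierFlow_add]
  have ha0 : a = 0 := eq_zero_of_weightedEnergy_fourierFlow_eq hK hsum hirr hw hKw hlam hξ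
    (e2.trans e1.symm)
  have hl : l = 0 := by
    rw [← e1, ha0]
    simp [weightedEnergy]
  rw [hl] at hlim
  rw [tendsto_zero_iff_norm_tendsto_zero]
  have h3 : Tendsto (fun t => √(C₂ * weightedEnergy w (S t y))) atTop (𝓝 0) := by
    simpa using (hlim.const_mul C₂).sqrt
  refine squeeze_zero (fun t => norm_nonneg _) (fun t => ?_) h3
  exact Real.le_sqrt_of_sq_le (h₂ _)

end Decay

/-! ### Fourier transform and weak derivatives in L² -/

section FourierL2

variable {F : Type*} [NormedAddCommGroup F] [InnerProductSpace ℂ F] [CompleteSpace F]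

/-- The L² transform agrees with that of tempered distributions, so it can be moved onto the
Schwartz function. -/
theorem integral_smul_fourier_toLp {f : ℝ → F} (hf : MemLp f 2 volume) (φ : 𝓢(ℝ, ℂ)) :
    ∫ x, φ x • (𝓕 (hf.toLp f) : Lp F 2 (volume : Measure ℝ)) x = ∫ x, (𝓕 φ) x • f x := by
  have h := DFunLike.congr_fun (Lp.fourier_toTemperedDistribution_eq (hf.toLp f)) φ
  rw [TemperedDistribution.fourier_apply, Lp.toTemperedDistribution_apply,
    Lp.toTemperedDistribution_apply] at h
  rw [← h]
  refine integral_congr_ae ?_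
  filter_upwards [hf.coeFn_toLp] with x hx
  rw [hx]

theorem integral_smul_fourierInv_toLp {f : ℝ → F} (hf : MemLp f 2 volume) (φ : 𝓢(ℝ, ℂ)) :
    ∫ x, φ x • (𝓕⁻ (hf.toLp f) : Lp F 2 (volume : Measure ℝ)) x = ∫ x, (𝓕⁻ φ) x • f x := by
  have h := DFunLike.congr_fun (Lp.fourierInv_toTemperedDistribution_eq (hf.toLp f)) φ
  rw [TemperedDistribution.fourierInv_apply, Lp.toTemperedDistribution_apply,
    Lp.toTemperedDistribution_apply] at h
  rw [← h]
  refine integral_congr_ae ?_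
  filter_upwards [hf.coeFn_toLp] with x hx
  rw [hx]

/-- Locally integrable functions that agree against Schwartz functions agree almost everywhere. -/
theorem ae_eq_of_integral_schwartz_smul_eq {f g : ℝ → F} (hf : LocallyIntegrable f volume)
    (hg : LocallyIntegrable g volume)
    (h : ∀ φ : 𝓢(ℝ, ℂ), ∫ x, φ x • f x = ∫ x, φ x • g x) : f =ᵐ[volume] g := by
  refine ae_eq_of_integral_contDiff_smul_eq hf hg fun φ hφ hφc => ?_
  have h₁ : HasCompactSupport (Complex.ofRealCLM ∘ φ) := hφc.comp_left rfl
  have h₂ : ContDiff ℝ ∞ (Complex.ofRealCLM ∘ φ) := by fun_prop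
  simpa using h (h₁.toSchwartzMap h₂)

/-- The multiplied function is packaged as a Schwartz function so that the duality identity can be
applied to it again. -/
theorem exists_deriv_fourier_schwartz (φ : 𝓢(ℝ, ℂ)) :
    ∃ ψ : 𝓢(ℝ, ℂ), (∀ x : ℝ, ψ x = -(2 * Real.pi * x * Complex.I : ℂ) * φ x) ∧
      ∀ x, deriv (𝓕 φ : 𝓢(ℝ, ℂ)) x = (𝓕 ψ : 𝓢(ℝ, ℂ)) x := by
  refine ⟨-(2 * Real.pi * Complex.I) • SchwartzMap.smulLeftCLM ℂ (inner ℝ · (1 : ℝ)) φ,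
    fun x => ?_, fun x => ?_⟩
  · have : (inner ℝ · (1 : ℝ)).HasTemperateGrowth := by fun_prop
    rw [smul_apply, SchwartzMap.smulLeftCLM_apply_apply this]
    simp
    ring
  · rw [← SchwartzMap.lineDerivOp_fourier_eq, SchwartzMap.lineDerivOp_apply_eq_fderiv,
      fderiv_apply_one_eq_deriv]

theorem exists_fourierInv_deriv_schwartz (φ : 𝓢(ℝ, ℂ)) :
    ∃ ψ : 𝓢(ℝ, ℂ), (∀ x, ψ x = deriv φ x) ∧
      ∀ x : ℝ, (𝓕⁻ ψ : 𝓢(ℝ, ℂ)) x =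
        -(2 * Real.pi * x * Complex.I : ℂ) * (𝓕⁻ φ : 𝓢(ℝ, ℂ)) x := by
  refine ⟨LineDeriv.lineDerivOp (1 : ℝ) φ, fun x => ?_, fun x => ?_⟩
  · rw [SchwartzMap.lineDerivOp_apply_eq_fderiv, fderiv_apply_one_eq_deriv]
  · have : (inner ℝ · (1 : ℝ)).HasTemperateGrowth := by fun_prop
    rw [SchwartzMap.fourierInv_lineDerivOp_eq, smul_apply, SchwartzMap.smulLeftCLM_apply_apply this]
    simp
    ring

/-- `g` is the weak derivative of `f` on the line, tested against Schwartz functions. -/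
def IsSchwartzWeakDeriv (f g : ℝ → F) : Prop :=
  ∀ φ : 𝓢(ℝ, ℂ), ∫ x, deriv φ x • f x = -∫ x, φ x • g x

/-- By duality: the transform moves onto φ, the weak derivative is tested against 𝓕 φ, and the
resulting factor moves back. The right-hand side is a priori only locally integrable, which is
enough for the comparison. -/
theorem IsSchwartzWeakDeriv.fourier_ae_eq {f g : ℝ → F} (hf : MemLp f 2 volume)
    (hg : MemLp g 2 volume) (h : IsSchwartzWeakDeriv f g) :
    (𝓕 (hg.toLp g) : Lp F 2 (volume : Measure ℝ)) =ᵐ[volume] fun ξ : ℝ =>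
      (2 * Real.pi * ξ * Complex.I : ℂ) • (𝓕 (hf.toLp f) : Lp F 2 (volume : Measure ℝ)) ξ := by
  refine ae_eq_of_integral_schwartz_smul_eq ((Lp.memLp _).locallyIntegrable one_le_two) ?_
    fun φ => ?_
  · rw [← locallyIntegrableOn_univ]
    exact LocallyIntegrableOn.continuousOn_smul isOpen_univ.isLocallyClosed
      (locallyIntegrableOn_univ.2 ((Lp.memLp _).locallyIntegrable one_le_two))
      (by fun_prop : Continuous fun ξ : ℝ => (2 * Real.pi * ξ * Complex.I : ℂ)).continuousOn
  · obtain ⟨ψ, hψ, hd⟩ := exists_deriv_fourier_schwartz φ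
    rw [integral_smul_fourier_toLp, ← neg_eq_iff_eq_neg.2 (h (𝓕 φ))]
    simp_rw [hd]
    rw [← integral_smul_fourier_toLp hf, ← integral_neg]
    refine integral_congr_ae (Eventually.of_forall fun x => ?_)
    simp only [hψ, smul_smul, ← neg_smul]
    ring_nf

theorem isSchwartzWeakDeriv_fourierInv {p q : ℝ → F} (hp : MemLp p 2 volume)
    (hq : MemLp q 2 volume)
    (h : ∀ ξ : ℝ, q ξ = (2 * Real.pi * ξ * Complex.I : ℂ) • p ξ) :
    IsSchwartzWeakDeriv (𝓕⁻ (hp.toLp p) : Lp F 2 (volume : Measure ℝ))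
      (𝓕⁻ (hq.toLp q) : Lp F 2 (volume : Measure ℝ)) := by
  intro φ
  obtain ⟨ψ, hψ, hd⟩ := exists_fourierInv_deriv_schwartz φ
  simp_rw [← hψ]
  rw [integral_smul_fourierInv_toLp, integral_smul_fourierInv_toLp, ← integral_neg]
  refine integral_congr_ae (Eventually.of_forall fun x => ?_)
  simp only [hd, h, smul_smul, ← neg_smul]
  ring_nf

/-- The `L²` inverse Fourier transform of an integrable function is the Fourier integral. -/
theorem fourierInv_toLp_ae_eq {p : ℝ → F} (hp : MemLp p 2 volume) (hp1 : Integrable p volume) :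
    (𝓕⁻ (hp.toLp p) : Lp F 2 (volume : Measure ℝ)) =ᵐ[volume] 𝓕⁻ p := by
  have hcont : Continuous (𝓕⁻ p) := by
    have h1 : Continuous (𝓕 p) := VectorFourier.fourierIntegral_continuous
      Real.continuous_fourierChar (by fun_prop) hp1
    rw [show 𝓕⁻ p = fun x => 𝓕 p (-x) from funext fun x => Real.fourierInv_eq_fourier_neg p x]
    fun_prop
  refine ae_eq_of_integral_schwartz_smul_eq ((Lp.memLp _).locallyIntegrable one_le_two)
    hcont.locallyIntegrable fun φ => ?_
  rw [integral_smul_fourierInv_toLp, SchwartzMap.fourierInv_coe]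
  -- For the pairing `-innerₗ ℝ` the general Fourier integral is the inverse transform; the pairing
  -- is symmetric, so the identity is self-adjointness.
  have h := VectorFourier.integral_fourierIntegral_smul_eq_flip (L := -innerₗ ℝ)
    (μ := (volume : Measure ℝ)) (ν := (volume : Measure ℝ))
    (f := fun x => φ x) (g := p) Real.continuous_fourierChar (by fun_prop) φ.integrable hp1
  have hflip : (-innerₗ ℝ : ℝ →ₗ[ℝ] ℝ →ₗ[ℝ] ℝ).flip = -innerₗ ℝ := by
    ext
    simp
  rw [hflip] at h
  exact h

end FourierL2

/-! ### The solution on the line -/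

section FourierSolution

variable {F : Type*} [NormedAddCommGroup F] [InnerProductSpace ℂ F] {K L : F →L[ℂ] F} {C : ℝ}

/-- The solution of `u_t + L u_x = K u` on the line whose initial value has Fourier transform
`w`. -/
noncomputable def fourierSolution (K L : F →L[ℂ] F) (w : ℝ → F) (x t : ℝ) : F :=
  𝓕⁻ (fun ξ => fourierFlow K L t ξ (w ξ)) x

theorem fourierSolution_eq (w : ℝ → F) (x t : ℝ) :
    fourierSolution K L w x t = ∫ ξ : ℝ, (𝐞 (ξ * x) : ℂ) • fourierFlow K L t ξ (w ξ) := by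
  simp [fourierSolution, Real.fourierInv_eq, mul_comm, Circle.smul_def]

theorem norm_fourierFlow_apply_le (hC : ∀ t ξ, 0 ≤ t → ‖fourierFlow K L t ξ‖ ≤ C) {t : ℝ}
    (ht : 0 ≤ t) (ξ : ℝ) (y : F) : ‖fourierFlow K L t ξ y‖ ≤ C * ‖y‖ :=
  (fourierFlow K L t ξ).le_of_opNorm_le (hC t ξ ht) y

theorem hasDerivAt_fourierInv {f : ℝ → F} (hf : Integrable f volume)
    (hf' : Integrable (fun ξ : ℝ => ξ • f ξ) volume) (x : ℝ) :
    HasDerivAt (𝓕⁻ f) (𝓕⁻ (fun ξ : ℝ => (2 * Real.pi * ξ * Complex.I : ℂ) • f ξ) x) x := by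
  have h := (Real.hasDerivAt_fourier hf hf' (-x)).scomp x (hasDerivAt_neg x)
  rw [show 𝓕⁻ f = 𝓕 f ∘ Neg.neg from funext fun x => Real.fourierInv_eq_fourier_neg f x]
  convert! h using 1
  rw [Real.fourierInv_eq_fourier_neg, neg_one_smul, Real.fourier_eq, Real.fourier_eq,
    ← integral_neg]
  refine integral_congr_ae (Eventually.of_forall fun ξ => ?_)
  beta_reduce
  rw [← smul_neg, ← neg_smul]
  congr 2
  ring

/-- The bound does not depend on x; it turns L¹ decay in frequency into uniform decay in space. -/
theorem norm_fourierSolution_le (w : ℝ → F) (x t : ℝ) :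
    ‖fourierSolution K L w x t‖ ≤ ∫ ξ, ‖fourierFlow K L t ξ (w ξ)‖ := by
  rw [fourierSolution_eq]
  refine (norm_integral_le_integral_norm _).trans_eq ?_
  refine integral_congr_ae (Eventually.of_forall fun ξ => ?_)
  simp only [norm_smul, Circle.norm_coe, one_mul]

variable [CompleteSpace F]

theorem aestronglyMeasurable_fourierFlow {w : ℝ → F} (hw : AEStronglyMeasurable w volume) (t : ℝ) :
    AEStronglyMeasurable (fun ξ => fourierFlow K L t ξ (w ξ)) volume := by
  have h : Continuous fun ξ : ℝ => fourierFlow K L t ξ :=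
    (continuous_fourierFlow K L).comp (by fun_prop : Continuous fun ξ : ℝ => (t, ξ))
  exact (isBoundedBilinearMap_apply (𝕜 := ℂ) (E := F) (F := F)).continuous.comp_aestronglyMeasurable₂
    h.aestronglyMeasurable hw

theorem integrable_fourierFlow (hC : ∀ t ξ, 0 ≤ t → ‖fourierFlow K L t ξ‖ ≤ C) {w : ℝ → F}
    (hw : Integrable w volume) {t : ℝ} (ht : 0 ≤ t) :
    Integrable (fun ξ => fourierFlow K L t ξ (w ξ)) volume :=
  (hw.norm.const_mul C).mono' (aestronglyMeasurable_fourierFlow hw.1 t)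
    (Eventually.of_forall fun ξ => norm_fourierFlow_apply_le hC ht ξ _)

theorem memLp_fourierFlow (hC : ∀ t ξ, 0 ≤ t → ‖fourierFlow K L t ξ‖ ≤ C) {w : ℝ → F}
    {p : ℝ≥0∞} (hw : MemLp w p volume) {t : ℝ} (ht : 0 ≤ t) :
    MemLp (fun ξ => fourierFlow K L t ξ (w ξ)) p volume :=
  hw.of_le_mul (aestronglyMeasurable_fourierFlow hw.1 t)
    (Eventually.of_forall fun ξ => norm_fourierFlow_apply_le hC ht ξ _)

theorem continuousOn_fourierSolution (hC : ∀ t ξ, 0 ≤ t → ‖fourierFlow K L t ξ‖ ≤ C) {w : ℝ → F}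
    (hw : Integrable w volume) :
    ContinuousOn (fun p : ℝ × ℝ => fourierSolution K L w p.1 p.2) (univ ×ˢ Ici 0) := by
  simp_rw [fourierSolution_eq]
  refine continuousOn_of_dominated (bound := fun ξ => C * ‖w ξ‖) ?_ ?_ (hw.norm.const_mul C) ?_
  · intro p hp
    have h : Continuous fun ξ : ℝ => (𝐞 (ξ * p.1) : ℂ) := by fun_prop
    exact h.aestronglyMeasurable.smul (aestronglyMeasurable_fourierFlow hw.1 p.2)
  · refine fun p hp => Eventually.of_forall fun ξ => ?_
    rw [norm_smul, Circle.norm_coe, one_mul]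
    exact norm_fourierFlow_apply_le hC hp.2 ξ _
  · refine Eventually.of_forall fun ξ => Continuous.continuousOn ?_
    have h : Continuous fun p : ℝ × ℝ => fourierFlow K L p.2 ξ :=
      (continuous_fourierFlow K L).comp (by fun_prop : Continuous fun p : ℝ × ℝ => (p.2, ξ))
    have h2 : Continuous fun p : ℝ × ℝ => (𝐞 (ξ * p.1) : ℂ) := by fun_prop
    exact h2.smul (h.clm_apply continuous_const)

/-- Differentiation under the integral. The generator grows linearly in ξ, hence the integrable
first moment. -/
theorem hasDerivAt_fourierSolution_time (hC : ∀ t ξ, 0 ≤ t → ‖fourierFlow K L t ξ‖ ≤ C)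
    {w : ℝ → F} (hw : Integrable w volume) (hw' : Integrable (fun ξ : ℝ => ξ • w ξ) volume)
    (x : ℝ) {t : ℝ} (ht : 0 < t) :
    HasDerivAt (fun s => fourierSolution K L w x s) (∫ ξ : ℝ, (𝐞 (ξ * x) : ℂ) •
      (K (fourierFlow K L t ξ (w ξ)) -
        (2 * Real.pi * ξ * Complex.I : ℂ) • L (fourierFlow K L t ξ (w ξ)))) t := by
  simp_rw [fourierSolution_eq]
  have he : Continuous fun ξ : ℝ => (𝐞 (ξ * x) : ℂ) := by fun_prop
  have hξ : Continuous fun ξ : ℝ => (2 * Real.pi * ξ * Complex.I : ℂ) := by fun_prop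
  have hm := aestronglyMeasurable_fourierFlow (K := K) (L := L) hw.1
  refine (hasDerivAt_integral_of_dominated_loc_of_deriv_le (𝕜 := ℝ)
    (bound := fun ξ => ‖K‖ * C * ‖w ξ‖ + 2 * Real.pi * ‖L‖ * C * ‖ξ • w ξ‖)
    (F' := fun s ξ => (𝐞 (ξ * x) : ℂ) • (K (fourierFlow K L s ξ (w ξ)) -
        (2 * Real.pi * ξ * Complex.I : ℂ) • L (fourierFlow K L s ξ (w ξ))))
    (Ioi_mem_nhds ht) ?_ ?_ ?_ ?_ ?_ ?_).2
  · exact Eventually.of_forall fun s => he.aestronglyMeasurable.smul (hm s)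
  · refine ((integrable_fourierFlow hC hw ht.le).norm).mono'
      (he.aestronglyMeasurable.smul (hm t)) (Eventually.of_forall fun ξ => ?_)
    rw [norm_smul, Circle.norm_coe, one_mul]
  · exact he.aestronglyMeasurable.smul ((K.continuous.comp_aestronglyMeasurable (hm t)).sub
      (hξ.aestronglyMeasurable.smul (L.continuous.comp_aestronglyMeasurable (hm t))))
  · refine Eventually.of_forall fun ξ s hs => ?_
    have hb := norm_fourierFlow_apply_le hC (le_of_lt hs) ξ (w ξ)
    rw [norm_smul, Circle.norm_coe, one_mul]
    refine (norm_sub_le _ _).trans (add_le_add ?_ ?_)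
    · rw [mul_assoc]
      exact (K.le_opNorm _).trans (by gcongr)
    · rw [norm_smul]
      have h1 : ‖(2 * Real.pi * ξ * Complex.I : ℂ)‖ = 2 * Real.pi * |ξ| := by
        simp [abs_of_pos Real.pi_pos]
      rw [h1, norm_smul, Real.norm_eq_abs]
      calc 2 * Real.pi * |ξ| * ‖L (fourierFlow K L s ξ (w ξ))‖
          ≤ 2 * Real.pi * |ξ| * (‖L‖ * (C * ‖w ξ‖)) := by
            gcongr
            exact (L.le_opNorm _).trans (by gcongr)
        _ = _ := by ring
  · exact (hw.norm.const_mul _).add (hw'.norm.const_mul _)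
  · refine Eventually.of_forall fun ξ s _ => ?_
    exact (hasDerivAt_fourierFlow_apply K L s ξ (w ξ)).const_smul (𝐞 (ξ * x) : ℂ)

/-- `fourierSolution` satisfies the transport equation. -/
theorem fourierSolution_equation (hC : ∀ t ξ, 0 ≤ t → ‖fourierFlow K L t ξ‖ ≤ C)
    {w : ℝ → F} (hw : Integrable w volume) (hw' : Integrable (fun ξ : ℝ => ξ • w ξ) volume)
    (x : ℝ) {t : ℝ} (ht : 0 < t) : ∃ ut ux : F,
      HasDerivAt (fun s => fourierSolution K L w x s) ut t ∧
      HasDerivAt (fun y => fourierSolution K L w y t) ux x ∧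
      ut + L ux = K (fourierSolution K L w x t) := by
  have hS := integrable_fourierFlow hC hw ht.le
  have hS' : Integrable (fun ξ : ℝ => ξ • fourierFlow K L t ξ (w ξ)) volume := by
    simpa using integrable_fourierFlow hC hw' ht.le
  have hS'' : Integrable (fun ξ : ℝ => (2 * Real.pi * ξ * Complex.I : ℂ) •
      fourierFlow K L t ξ (w ξ)) volume := by
    refine (hS'.smul (2 * Real.pi * Complex.I : ℂ)).congr (Eventually.of_forall fun ξ => ?_)
    simp only [Pi.smul_apply, ← Complex.coe_smul, smul_smul]
    ring_nf
  have he : Continuous fun ξ : ℝ => (𝐞 (ξ * x) : ℂ) := by fun_prop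
  have hint : ∀ {f : ℝ → F}, Integrable f volume →
      Integrable (fun ξ : ℝ => (𝐞 (ξ * x) : ℂ) • f ξ) volume := fun hf =>
    hf.norm.mono' (he.aestronglyMeasurable.smul hf.1) (Eventually.of_forall fun ξ => by
      rw [norm_smul, Circle.norm_coe, one_mul])
  refine ⟨_, _, hasDerivAt_fourierSolution_time hC hw hw' x ht,
    hasDerivAt_fourierInv hS hS' x, ?_⟩
  rw [fourierSolution_eq, ← K.integral_comp_comm (hint hS), Real.fourierInv_eq]
  have h1 : ∀ ξ : ℝ, 𝐞 (inner ℝ ξ x) • (2 * Real.pi * ξ * Complex.I : ℂ) •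
      fourierFlow K L t ξ (w ξ) = (𝐞 (ξ * x) : ℂ) • (2 * Real.pi * ξ * Complex.I : ℂ) •
      fourierFlow K L t ξ (w ξ) := fun ξ => by simp [Circle.smul_def, mul_comm]
  simp_rw [h1]
  rw [← L.integral_comp_comm (hint hS''), ← integral_add]
  · refine integral_congr_ae (Eventually.of_forall fun ξ => ?_)
    simp only [map_smul, ← smul_add, sub_add_cancel]
  · refine hint ((K.integrable_comp hS).sub ((L.integrable_comp hS'').congr ?_))
    exact Eventually.of_forall fun ξ => by simp
  · exact L.integrable_comp (hint hS'')

/-- Pointwise decay may fail only at ξ = 0, a null set, and C‖w‖ dominates. -/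
theorem tendsto_integral_norm_fourierFlow (hC : ∀ t ξ, 0 ≤ t → ‖fourierFlow K L t ξ‖ ≤ C)
    (hdecay : ∀ ξ ≠ 0, ∀ y, Tendsto (fun t => fourierFlow K L t ξ y) atTop (𝓝 0))
    {w : ℝ → F} (hw : Integrable w volume) :
    Tendsto (fun t => ∫ ξ, ‖fourierFlow K L t ξ (w ξ)‖) atTop (𝓝 0) := by
  have h := tendsto_integral_filter_of_dominated_convergence (l := atTop)
    (F := fun t ξ => ‖fourierFlow K L t ξ (w ξ)‖) (f := fun _ => 0) (fun ξ => C * ‖w ξ‖)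
    (Eventually.of_forall fun t => (aestronglyMeasurable_fourierFlow hw.1 t).norm) ?_
    (hw.norm.const_mul C) ?_
  · simpa using h
  · filter_upwards [eventually_ge_atTop 0] with t ht
    refine Eventually.of_forall fun ξ => ?_
    rw [norm_norm]
    exact norm_fourierFlow_apply_le hC ht ξ _
  · have h0 : ∀ᵐ ξ : ℝ ∂volume, ξ ≠ 0 := by simp [ae_iff]
    filter_upwards [h0] with ξ hξ
    simpa using (hdecay ξ hξ (w ξ)).norm

/-- Strong continuity of the propagator on `L²`. -/
theorem tendsto_eLpNorm_fourierFlow_sub (hC : ∀ t ξ, 0 ≤ t → ‖fourierFlow K L t ξ‖ ≤ C)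
    {q : ℝ → F} (hq : MemLp q 2 volume) {t : ℝ} (ht : 0 ≤ t) :
    Tendsto (fun s => eLpNorm (fun ξ => fourierFlow K L s ξ (q ξ) - fourierFlow K L t ξ (q ξ)) 2
      volume) (𝓝[Ici 0] t) (𝓝 0) := by
  have hfin := lintegral_rpow_enorm_lt_top_of_eLpNorm_lt_top two_ne_zero ENNReal.ofNat_ne_top
    (hq.norm.const_mul (2 * C)).eLpNorm_lt_top
  simp_rw [eLpNorm_eq_lintegral_rpow_enorm_toReal two_ne_zero ENNReal.ofNat_ne_top]
  have h := tendsto_lintegral_filter_of_dominated_convergence' (μ := (volume : Measure ℝ))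
    (l := 𝓝[Ici 0] t)
    (F := fun s ξ => ‖fourierFlow K L s ξ (q ξ) - fourierFlow K L t ξ (q ξ)‖ₑ ^ (2 : ℝ≥0∞).toReal)
    (f := fun _ => 0) (fun ξ => ‖2 * C * ‖q ξ‖‖ₑ ^ (2 : ℝ≥0∞).toReal) ?_ ?_ hfin.ne ?_
  · simpa using h.ennrpow_const (1 / (2 : ℝ≥0∞).toReal)
  · refine Eventually.of_forall fun s => ?_
    exact (((aestronglyMeasurable_fourierFlow hq.1 s).sub
      (aestronglyMeasurable_fourierFlow hq.1 t)).enorm.pow_const _)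
  · filter_upwards [self_mem_nhdsWithin] with s hs
    refine Eventually.of_forall fun ξ => ?_
    gcongr
    rw [enorm_le_iff_norm_le]
    refine (norm_sub_le _ _).trans ((add_le_add (norm_fourierFlow_apply_le hC hs ξ _)
      (norm_fourierFlow_apply_le hC ht ξ _)).trans ?_)
    refine (le_of_eq ?_).trans (le_abs_self _)
    ring
  · refine Eventually.of_forall fun ξ => ?_
    have h1 : Tendsto (fun s => fourierFlow K L s ξ (q ξ)) (𝓝[Ici 0] t)
        (𝓝 (fourierFlow K L t ξ (q ξ))) :=
      (hasDerivAt_fourierFlow_apply K L t ξ (q ξ)).continuousAt.tendsto.mono_left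
        nhdsWithin_le_nhds
    have h2 := ((h1.sub_const (fourierFlow K L t ξ (q ξ))).enorm).ennrpow_const
      (2 : ℝ≥0∞).toReal
    simpa using h2

/-- Plancherel for differences. -/
theorem eLpNorm_fourierInv_sub {p q : ℝ → F} (hp : MemLp p 2 volume) (hq : MemLp q 2 volume) :
    eLpNorm (fun x => (𝓕⁻ (hp.toLp p) : Lp F 2 (volume : Measure ℝ)) x -
      (𝓕⁻ (hq.toLp q) : Lp F 2 (volume : Measure ℝ)) x) 2 volume =
      eLpNorm (fun ξ => p ξ - q ξ) 2 volume := by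
  have h1 : ∀ f : Lp F 2 (volume : Measure ℝ), ‖𝓕⁻ f‖ₑ = ‖f‖ₑ := fun f => by
    rw [enorm_eq_iff_norm_eq, ← Lp.norm_fourier_eq, FourierTransform.fourier_fourierInv_eq]
  have h2 := h1 (hp.toLp p - hq.toLp q)
  rw [sub_eq_add_neg, FourierTransform.fourierInv_add, FourierTransform.fourierInv_neg,
    ← sub_eq_add_neg, ← sub_eq_add_neg, ← MemLp.toLp_sub, Lp.enorm_toLp, Lp.enorm_def,
    eLpNorm_congr_ae (Lp.coeFn_sub _ _)] at h2
  exact h2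

end FourierSolution

/-! ### A smooth cutoff -/

section Cutoff

/-- A smooth function which is `0` up to `1` and `1` from `2` on. -/
noncomputable def smoothStep (x : ℝ) : ℝ := Real.smoothTransition (x - 1)

theorem contDiff_smoothStep : ContDiff ℝ ∞ smoothStep :=
  Real.smoothTransition.contDiff.comp (contDiff_id.sub contDiff_const)

theorem smoothStep_of_le {x : ℝ} (h : x ≤ 1) : smoothStep x = 0 :=
  Real.smoothTransition.zero_of_nonpos (by linarith)

theorem smoothStep_of_ge {x : ℝ} (h : 2 ≤ x) : smoothStep x = 1 :=
  Real.smoothTransition.one_of_one_le (by linarith)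

theorem abs_smoothStep_le (x : ℝ) : |smoothStep x| ≤ 1 := by
  rw [smoothStep, abs_of_nonneg (Real.smoothTransition.nonneg _)]
  exact Real.smoothTransition.le_one _

theorem contDiff_deriv_smoothStep : ContDiff ℝ ∞ (deriv smoothStep) :=
  (contDiff_infty_iff_deriv.1 contDiff_smoothStep).2

theorem deriv_eq_zero_of_eqOn {f : ℝ → ℝ} {c x : ℝ} {s : Set ℝ} (hs : s ∈ 𝓝 x)
    (h : ∀ y ∈ s, f y = c) : deriv f x = 0 := by
  have : f =ᶠ[𝓝 x] fun _ => c := by filter_upwards [hs] with y hy using h y hy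
  rw [this.deriv_eq, deriv_const]

theorem deriv_smoothStep_eq_zero {x : ℝ} (hx : x ∉ Icc (1 : ℝ) 2) : deriv smoothStep x = 0 := by
  rw [mem_Icc, not_and_or, not_le, not_le] at hx
  rcases hx with hx | hx
  · exact deriv_eq_zero_of_eqOn (Iio_mem_nhds hx) fun y hy => smoothStep_of_le (le_of_lt hy)
  · exact deriv_eq_zero_of_eqOn (Ioi_mem_nhds hx) fun y hy => smoothStep_of_ge (le_of_lt hy)

theorem deriv_deriv_smoothStep_eq_zero {x : ℝ} (hx : x ∉ Icc (1 : ℝ) 2) :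
    deriv (deriv smoothStep) x = 0 :=
  deriv_eq_zero_of_eqOn (isClosed_Icc.isOpen_compl.mem_nhds hx) fun _ hy =>
    deriv_smoothStep_eq_zero hy

theorem exists_abs_le_of_eq_zero {θ : ℝ → ℝ} (hθ : Continuous θ)
    (h0 : ∀ x ∉ Icc (1 : ℝ) 2, θ x = 0) : ∃ M, 0 ≤ M ∧ ∀ x, |θ x| ≤ M := by
  obtain ⟨M, hM⟩ := isCompact_Icc.exists_bound_of_continuousOn (hθ.continuousOn (s := Icc 1 2))
  have hM0 : 0 ≤ M := (norm_nonneg _).trans (hM 1 (by norm_num))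
  refine ⟨M, hM0, fun x => ?_⟩
  by_cases hx : x ∈ Icc (1 : ℝ) 2
  · exact hM x hx
  · simpa [h0 x hx]

end Cutoff

/-! ### Enlarging the class of test functions on the half-line -/

section Extension

variable {E : Type*} [NormedAddCommGroup E] [NormedSpace ℝ E]

theorem integrable_mul_smul_halfLine {a ψ : ℝ → ℝ} {f : ℝ → E} {M : ℝ} (ha : Continuous a)
    (haM : ∀ x, |a x| ≤ M) (hψ : MemLp ψ 2 halfLine) (hf : MemLp f 2 halfLine) :
    Integrable (fun x => (a x * ψ x) • f x) halfLine := by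
  have h : MemLp (fun x => a x * ψ x) 2 halfLine := by
    refine hψ.of_le_mul (c := M) (ha.aestronglyMeasurable.mul hψ.1)
      (Eventually.of_forall fun x => ?_)
    rw [norm_mul]
    exact mul_le_mul_of_nonneg_right (haM x) (norm_nonneg _)
  exact memLp_one_iff_integrable.1 (hf.smul h)

theorem tendsto_integral_mul_smul_halfLine {a : ℕ → ℝ → ℝ} {b : ℝ} {ψ : ℝ → ℝ} {f : ℝ → E}
    {M : ℝ} (ha : ∀ n, Continuous (a n)) (haM : ∀ n x, |a n x| ≤ M)
    (hlim : ∀ x, 0 < x → Tendsto (fun n => a n x) atTop (𝓝 b))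
    (hψ : MemLp ψ 2 halfLine) (hf : MemLp f 2 halfLine) :
    Tendsto (fun n => ∫ x, (a n x * ψ x) • f x ∂halfLine) atTop
      (𝓝 (∫ x, (b * ψ x) • f x ∂halfLine)) := by
  have hint : Integrable (fun x => ψ x • f x) halfLine := memLp_one_iff_integrable.1 (hf.smul hψ)
  refine tendsto_integral_of_dominated_convergence (fun x => M * ‖ψ x • f x‖)
    (fun n => (integrable_mul_smul_halfLine (ha n) (haM n) hψ hf).1) (hint.norm.const_mul M)
    (fun n => Eventually.of_forall fun x => ?_) ?_
  · rw [mul_smul, norm_smul]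
    exact mul_le_mul_of_nonneg_right (haM n x) (norm_nonneg _)
  · rw [halfLine, ae_restrict_iff' measurableSet_Ioi]
    exact Eventually.of_forall fun x hx => ((hlim x hx).mul_const _).smul_const _

/-- Weak derivatives may be tested against square-integrable functions without compact support. -/
theorem AxonalTransport.IsWeakDeriv.integral_deriv_smul {f g : ℝ → E} (h : IsWeakDeriv f g)
    (hf : MemLp f 2 halfLine) (hg : MemLp g 2 halfLine) {ψ : ℝ → ℝ} (hψ : ContDiff ℝ ∞ ψ)
    (hsupp : tsupport ψ ⊆ Ioi 0) (h0 : MemLp ψ 2 halfLine) (h1 : MemLp (deriv ψ) 2 halfLine) :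
    ∫ x, deriv ψ x • f x ∂halfLine = -∫ x, ψ x • g x ∂halfLine := by
  obtain ⟨M, hM0, hM⟩ := exists_abs_le_of_eq_zero contDiff_deriv_smoothStep.continuous
    fun x hx => deriv_smoothStep_eq_zero hx
  let c : ℕ → ℝ := fun n => 1 / ((n : ℝ) + 1)
  have hc0 : ∀ n, 0 < c n := fun n => by positivity
  have hc1 : ∀ n, c n ≤ 1 := fun n => by
    rw [div_le_one (by positivity)]
    linarith [n.cast_nonneg (α := ℝ)]
  have hc : Tendsto c atTop (𝓝 0) := tendsto_one_div_add_atTop_nhds_zero_nat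
  -- A cutoff at infinity. The scale c n ≤ 1 keeps its derivative bounded by M, while c n → 0 makes
  -- that derivative vanish in the limit.
  let a : ℕ → ℝ → ℝ := fun n x => 1 - smoothStep (c n * x)
  let a' : ℕ → ℝ → ℝ := fun n x => -(c n * deriv smoothStep (c n * x))
  have hasm : ∀ n, ContDiff ℝ ∞ (a n) := fun n =>
    contDiff_const.sub (contDiff_smoothStep.comp (contDiff_const.mul contDiff_id))
  have ha' : ∀ n, Continuous (a' n) := fun n => by
    have := contDiff_deriv_smoothStep.continuous
    fun_prop
  have hder : ∀ n x, HasDerivAt (a n) (a' n x) x := fun n x => by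
    have h1 : HasDerivAt (fun y => c n * y) (c n) x := by
      simpa using (hasDerivAt_id x).const_mul (c n)
    have h2 := ((contDiff_smoothStep.differentiable (by simp)) (c n * x)).hasDerivAt.comp x h1
    have h3 := h2.const_sub 1
    rw [mul_comm] at h3
    exact h3
  have haM : ∀ n x, |a n x| ≤ 2 := fun n x => by
    have := abs_le.1 (abs_smoothStep_le (c n * x))
    rw [abs_le]
    constructor <;> simp only [a] <;> linarith
  have haM' : ∀ n x, |a' n x| ≤ M := fun n x => by
    simp only [a', abs_neg, abs_mul, abs_of_pos (hc0 n)]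
    exact (mul_le_of_le_one_left (abs_nonneg _) (hc1 n)).trans (hM _)
  have hcx : ∀ x, Tendsto (fun n => c n * x) atTop (𝓝 0) := fun x => by
    simpa using hc.mul_const x
  have hlim : ∀ x, 0 < x → Tendsto (fun n => a n x) atTop (𝓝 1) := fun x _ => by
    have : Tendsto (fun n => a n x) atTop (𝓝 (1 - smoothStep 0)) :=
      ((contDiff_smoothStep.continuous.tendsto 0).comp (hcx x)).const_sub 1
    simpa [smoothStep_of_le zero_le_one] using this
  have hlim' : ∀ x, 0 < x → Tendsto (fun n => a' n x) atTop (𝓝 0) := fun x _ => by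
    have : Tendsto (fun n => a' n x) atTop (𝓝 (-(0 * deriv smoothStep 0))) :=
      (hc.mul ((contDiff_deriv_smoothStep.continuous.tendsto 0).comp (hcx x))).neg
    simpa using this
  have hid : ∀ n, ∫ x, (a n x * deriv ψ x) • f x ∂halfLine +
      ∫ x, (a' n x * ψ x) • f x ∂halfLine = -∫ x, (a n x * ψ x) • g x ∂halfLine := by
    intro n
    have hd : ∀ x, deriv (fun y => a n y * ψ y) x = a' n x * ψ x + a n x * deriv ψ x := fun x =>
      ((hder n x).mul ((hψ.differentiable (by simp)) x).hasDerivAt).deriv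
    rw [← h (fun x => a n x * ψ x) ((hasm n).mul hψ) ?_ ?_, ← integral_add]
    · refine integral_congr_ae (Eventually.of_forall fun x => ?_)
      simp only [hd, ← add_smul, add_comm]
    · exact integrable_mul_smul_halfLine (hasm n).continuous (haM n) h1 hf
    · exact integrable_mul_smul_halfLine (ha' n) (haM' n) h0 hf
    · refine HasCompactSupport.of_support_subset_isCompact
        (isCompact_Icc (a := 0) (b := 2 / c n)) fun x hx => ?_
      have hx1 : ψ x ≠ 0 := right_ne_zero_of_mul hx
      have hx2 : a n x ≠ 0 := left_ne_zero_of_mul hx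
      refine ⟨le_of_lt (hsupp (subset_tsupport _ hx1)), ?_⟩
      by_contra hlt
      rw [not_le, div_lt_iff₀ (hc0 n)] at hlt
      exact hx2 (by simp only [a]; rw [smoothStep_of_ge (by linarith), sub_self])
    · exact (closure_mono fun x hx => right_ne_zero_of_mul hx).trans hsupp
  have hL := (tendsto_integral_mul_smul_halfLine (fun n => (hasm n).continuous) haM hlim h1 hf).add
    (tendsto_integral_mul_smul_halfLine ha' haM' hlim' h0 hf)
  have hR := (tendsto_integral_mul_smul_halfLine (fun n => (hasm n).continuous) haM hlim h0 hg).neg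
  have := tendsto_nhds_unique (hL.congr hid) hR
  simpa using this

/-- Concentrating weights do not see a function vanishing to sufficient order at the origin. -/
theorem tendsto_integral_concentrating_smul {θ ψ : ℝ → ℝ} (hθ : Continuous θ)
    (hθ0 : ∀ x ∉ Icc (1 : ℝ) 2, θ x = 0) (hψ : Continuous ψ) {f : ℝ → E} (k : ℕ)
    (hf : f =o[𝓝[>] 0] fun x => x ^ k) :
    Tendsto (fun n : ℕ => ∫ x, ((n : ℝ) ^ (k + 1) * θ (n * x) * ψ x) • f x ∂halfLine) atTop
      (𝓝 0) := by
  obtain ⟨M, hM0, hM⟩ := exists_abs_le_of_eq_zero hθ hθ0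
  obtain ⟨P, hP⟩ := isCompact_Icc.exists_bound_of_continuousOn (hψ.continuousOn (s := Icc 0 2))
  have hP0 : 0 ≤ P := (norm_nonneg _).trans (hP 0 (by norm_num))
  rw [Metric.tendsto_atTop]
  intro ε hε
  -- The weight has size n^(k+1) on an interval of length 1/n, where ‖f‖ ≤ δ(2/n)^k; the powers of n
  -- cancel and leave M P 2^k δ < ε. The summand 1 keeps the denominator positive if M P = 0.
  set δ : ℝ := ε / (2 * (M * P * 2 ^ k + 1)) with hδ
  have hδ0 : 0 < δ := by positivity
  have hev := hf.def hδ0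
  rw [eventually_iff, mem_nhdsGT_iff_exists_Ioo_subset] at hev
  obtain ⟨d, hd0, hd⟩ := hev
  obtain ⟨N, hN⟩ := exists_nat_gt (2 / d)
  refine ⟨max N 1, fun n hn => ?_⟩
  have hn1 : (1 : ℝ) ≤ n := by exact_mod_cast (le_max_right _ _).trans hn
  have hn0 : (0 : ℝ) < n := by linarith
  have hnd : 2 / (n : ℝ) < d := by
    have : (N : ℝ) ≤ n := by exact_mod_cast (le_max_left _ _).trans hn
    rw [div_lt_comm₀ hn0 hd0]
    linarith
  rw [dist_zero_right, halfLine]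
  have hsub : Icc (1 / (n : ℝ)) (2 / n) ⊆ Ioi 0 := fun x hx =>
    lt_of_lt_of_le (by positivity) hx.1
  rw [setIntegral_eq_of_subset_of_forall_sdiff_eq_zero measurableSet_Ioi hsub]
  · have hb : ∀ x ∈ Icc (1 / (n : ℝ)) (2 / n),
        ‖((n : ℝ) ^ (k + 1) * θ (n * x) * ψ x) • f x‖ ≤
          (n : ℝ) ^ (k + 1) * M * P * (δ * (2 / n) ^ k) := fun x hx => by
      have hx0 : 0 < x := hsub hx
      have h1 : ‖f x‖ ≤ δ * x ^ k := by
        have := hd ⟨hx0, hx.2.trans_lt hnd⟩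
        simpa [abs_of_pos hx0] using this
      have h2 : |ψ x| ≤ P := hP x ⟨hx0.le, hx.2.trans (div_le_self zero_le_two hn1)⟩
      rw [norm_smul, norm_mul, norm_mul, Real.norm_eq_abs, Real.norm_eq_abs, Real.norm_eq_abs,
        abs_of_pos (pow_pos hn0 _)]
      have h3 : δ * x ^ k ≤ δ * (2 / n) ^ k := by
        gcongr
        exact hx.2
      exact mul_le_mul (mul_le_mul (mul_le_mul_of_nonneg_left (hM _) (by positivity)) h2
        (abs_nonneg _) (by positivity)) (h1.trans h3) (norm_nonneg _) (by positivity)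
    have h4 := norm_setIntegral_le_of_norm_le_const (μ := volume)
      (measure_Icc_lt_top (a := 1 / (n : ℝ)) (b := 2 / n)) hb
    have hvol : volume.real (Icc (1 / (n : ℝ)) (2 / n)) = 1 / n := by
      rw [Real.volume_real_Icc_of_le (by gcongr; norm_num)]
      ring
    rw [hvol] at h4
    refine h4.trans_lt ?_
    have h5 : (n : ℝ) ^ (k + 1) * M * P * (δ * (2 / n) ^ k) * (1 / n) = M * P * 2 ^ k * δ := by
      rw [div_pow, pow_succ]
      field_simp
    rw [h5, hδ, ← mul_div_assoc, div_lt_iff₀ (by positivity)]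
    have : 0 ≤ M * P * 2 ^ k := by positivity
    nlinarith
  · intro x hx
    have : (n : ℝ) * x ∉ Icc (1 : ℝ) 2 := fun h => hx.2
      ⟨by rw [div_le_iff₀ hn0]; linarith [h.1], by rw [le_div_iff₀ hn0]; linarith [h.2]⟩
    rw [hθ0 _ this]
    simp

theorem exists_abs_deriv_smoothStep_le : ∃ M, 0 ≤ M ∧ ∀ x, |deriv smoothStep x| ≤ M :=
  exists_abs_le_of_eq_zero contDiff_deriv_smoothStep.continuous fun _ hx =>
    deriv_smoothStep_eq_zero hx

theorem exists_abs_deriv_deriv_smoothStep_le :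
    ∃ M, 0 ≤ M ∧ ∀ x, |deriv (deriv smoothStep) x| ≤ M :=
  exists_abs_le_of_eq_zero (contDiff_infty_iff_deriv.1 contDiff_deriv_smoothStep).2.continuous
    fun _ hx => deriv_deriv_smoothStep_eq_zero hx

theorem tendsto_smoothStep_mul {x : ℝ} (hx : 0 < x) :
    Tendsto (fun n : ℕ => smoothStep (n * x)) atTop (𝓝 1) := by
  refine tendsto_const_nhds.congr' ?_
  filter_upwards [(tendsto_natCast_atTop_atTop.atTop_mul_const hx).eventually_ge_atTop 2] with n hn
  exact (smoothStep_of_ge hn).symm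

theorem hasDerivAt_comp_const_mul {f : ℝ → ℝ} (hf : ContDiff ℝ ∞ f) (c x : ℝ) :
    HasDerivAt (fun y => f (c * y)) (c * deriv f (c * x)) x := by
  have h1 : HasDerivAt (fun y => c * y) c x := by simpa using (hasDerivAt_id x).const_mul c
  have h2 := ((hf.differentiable (by simp)) (c * x)).hasDerivAt.comp x h1
  rwa [mul_comm] at h2

theorem memLp_mul_of_bounded {a ψ : ℝ → ℝ} {M : ℝ} (ha : Continuous a) (haM : ∀ x, |a x| ≤ M)
    (hψ : MemLp ψ 2 halfLine) : MemLp (fun x => a x * ψ x) 2 halfLine := by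
  refine hψ.of_le_mul (c := M) (ha.aestronglyMeasurable.mul hψ.1)
    (Eventually.of_forall fun x => ?_)
  rw [norm_mul]
  exact mul_le_mul_of_nonneg_right (haM x) (norm_nonneg _)

/-- A smooth function multiplied by the cutoff `smoothStep (n x)`. -/
noncomputable def cutoffNearZero (ψ : ℝ → ℝ) (n : ℕ) (x : ℝ) : ℝ := smoothStep (n * x) * ψ x

section CutoffNearZero

variable {ψ : ℝ → ℝ} (n : ℕ)

theorem contDiff_cutoffNearZero (hψ : ContDiff ℝ ∞ ψ) : ContDiff ℝ ∞ (cutoffNearZero ψ n) :=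
  (contDiff_smoothStep.comp (contDiff_const.mul contDiff_id)).mul hψ

theorem deriv_cutoffNearZero (hψ : ContDiff ℝ ∞ ψ) :
    deriv (cutoffNearZero ψ n) = fun x =>
      n * deriv smoothStep (n * x) * ψ x + smoothStep (n * x) * deriv ψ x :=
  funext fun x => ((hasDerivAt_comp_const_mul contDiff_smoothStep n x).mul
    ((hψ.differentiable (by simp)) x).hasDerivAt).deriv

theorem deriv_deriv_cutoffNearZero (hψ : ContDiff ℝ ∞ ψ) :
    deriv (deriv (cutoffNearZero ψ n)) = fun x =>
      (n : ℝ) ^ 2 * deriv (deriv smoothStep) (n * x) * ψ x +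
        2 * (n * deriv smoothStep (n * x) * deriv ψ x) +
        smoothStep (n * x) * deriv (deriv ψ) x := by
  rw [deriv_cutoffNearZero n hψ]
  have hψ' := (contDiff_infty_iff_deriv.1 hψ).2
  funext x
  have h1 := ((hasDerivAt_comp_const_mul contDiff_deriv_smoothStep n x).const_mul (n : ℝ)).mul
    ((hψ.differentiable (by simp)) x).hasDerivAt
  have h2 := (hasDerivAt_comp_const_mul contDiff_smoothStep n x).mul
    ((hψ'.differentiable (by simp)) x).hasDerivAt
  refine (h1.add h2).deriv.trans ?_
  ring

theorem tsupport_cutoffNearZero (hn : 0 < n) : tsupport (cutoffNearZero ψ n) ⊆ Ioi 0 := by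
  have hn' : (0 : ℝ) < n := by exact_mod_cast hn
  have h : tsupport (cutoffNearZero ψ n) ⊆ Ici (1 / (n : ℝ)) := by
    refine closure_minimal (fun x hx => ?_) isClosed_Ici
    by_contra hlt
    rw [mem_Ici, not_le, lt_div_iff₀ hn'] at hlt
    exact hx (by rw [cutoffNearZero, smoothStep_of_le (by linarith), zero_mul])
  exact h.trans fun x hx => lt_of_lt_of_le (show (0 : ℝ) < 1 / n by positivity) hx

theorem memLp_cutoffNearZero (h0 : MemLp ψ 2 halfLine) :
    MemLp (cutoffNearZero ψ n) 2 halfLine :=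
  memLp_mul_of_bounded (contDiff_smoothStep.continuous.comp (by fun_prop))
    (fun _ => abs_smoothStep_le _) h0

theorem memLp_deriv_smoothStep_mul (h0 : MemLp ψ 2 halfLine) :
    MemLp (fun x => n * deriv smoothStep (n * x) * ψ x) 2 halfLine := by
  obtain ⟨M, -, hM⟩ := exists_abs_deriv_smoothStep_le
  have hc := contDiff_deriv_smoothStep.continuous
  refine memLp_mul_of_bounded (M := n * M) (by fun_prop) (fun x => ?_) h0
  rw [abs_mul, Nat.abs_cast]
  exact mul_le_mul_of_nonneg_left (hM _) n.cast_nonneg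

theorem memLp_deriv_deriv_smoothStep_mul (h0 : MemLp ψ 2 halfLine) :
    MemLp (fun x => (n : ℝ) ^ 2 * deriv (deriv smoothStep) (n * x) * ψ x) 2 halfLine := by
  obtain ⟨M, -, hM⟩ := exists_abs_deriv_deriv_smoothStep_le
  have hc := (contDiff_infty_iff_deriv.1 contDiff_deriv_smoothStep).2.continuous
  refine memLp_mul_of_bounded (M := (n : ℝ) ^ 2 * M) (by fun_prop) (fun x => ?_) h0
  rw [abs_mul, abs_of_nonneg (by positivity : (0 : ℝ) ≤ (n : ℝ) ^ 2)]
  exact mul_le_mul_of_nonneg_left (hM _) (by positivity)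

theorem memLp_deriv_cutoffNearZero (hψ : ContDiff ℝ ∞ ψ) (h0 : MemLp ψ 2 halfLine)
    (h1 : MemLp (deriv ψ) 2 halfLine) : MemLp (deriv (cutoffNearZero ψ n)) 2 halfLine := by
  rw [deriv_cutoffNearZero n hψ]
  exact (memLp_deriv_smoothStep_mul n h0).add (memLp_cutoffNearZero n h1)

theorem memLp_deriv_deriv_cutoffNearZero (hψ : ContDiff ℝ ∞ ψ) (h0 : MemLp ψ 2 halfLine)
    (h1 : MemLp (deriv ψ) 2 halfLine) (h2 : MemLp (deriv (deriv ψ)) 2 halfLine) :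
    MemLp (deriv (deriv (cutoffNearZero ψ n))) 2 halfLine := by
  rw [deriv_deriv_cutoffNearZero n hψ]
  exact ((memLp_deriv_deriv_smoothStep_mul n h0).add
    ((memLp_deriv_smoothStep_mul n h1).const_mul 2)).add (memLp_cutoffNearZero n h2)

theorem tendsto_integral_cutoffNearZero_smul {f : ℝ → E} (h0 : MemLp ψ 2 halfLine)
    (hf : MemLp f 2 halfLine) :
    Tendsto (fun n => ∫ x, cutoffNearZero ψ n x • f x ∂halfLine) atTop
      (𝓝 (∫ x, ψ x • f x ∂halfLine)) := by
  have hc := contDiff_smoothStep.continuous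
  simpa [cutoffNearZero] using tendsto_integral_mul_smul_halfLine (a := fun n x => smoothStep (n * x))
    (fun n => by fun_prop) (fun n x => abs_smoothStep_le _) (fun x hx => tendsto_smoothStep_mul hx)
    h0 hf

end CutoffNearZero

theorem integrable_smul_halfLine {ψ : ℝ → ℝ} {f : ℝ → E} (hψ : MemLp ψ 2 halfLine)
    (hf : MemLp f 2 halfLine) : Integrable (fun x => ψ x • f x) halfLine :=
  memLp_one_iff_integrable.1 (hf.smul hψ)

/-- If `f` vanishes at the origin, then its weak derivative may be tested against functions which
do not vanish there. -/
theorem AxonalTransport.IsWeakDeriv.integral_deriv_smul_of_tendsto_zero {f g : ℝ → E}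
    (h : IsWeakDeriv f g) (hf : MemLp f 2 halfLine) (hg : MemLp g 2 halfLine)
    (hf0 : Tendsto f (𝓝[>] 0) (𝓝 0)) {ψ : ℝ → ℝ} (hψ : ContDiff ℝ ∞ ψ)
    (h0 : MemLp ψ 2 halfLine) (h1 : MemLp (deriv ψ) 2 halfLine) :
    ∫ x, deriv ψ x • f x ∂halfLine = -∫ x, ψ x • g x ∂halfLine := by
  -- The cutoff near 0 makes ψ admissible; differentiating it produces a concentrating term, which
  -- vanishes because f → 0.
  have hid : ∀ᶠ n : ℕ in atTop,
      ∫ x, ((n : ℝ) ^ (0 + 1) * deriv smoothStep (n * x) * ψ x) • f x ∂halfLine +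
        ∫ x, cutoffNearZero (deriv ψ) n x • f x ∂halfLine =
      -∫ x, cutoffNearZero ψ n x • g x ∂halfLine := by
    filter_upwards [eventually_gt_atTop 0] with n hn
    rw [← h.integral_deriv_smul hf hg (contDiff_cutoffNearZero n hψ)
      (tsupport_cutoffNearZero n hn) (memLp_cutoffNearZero n h0)
      (memLp_deriv_cutoffNearZero n hψ h0 h1), deriv_cutoffNearZero n hψ, ← integral_add]
    · refine integral_congr_ae (Eventually.of_forall fun x => ?_)
      simp only [cutoffNearZero, ← add_smul, zero_add, pow_one]
    · simpa using integrable_smul_halfLine (memLp_deriv_smoothStep_mul n h0) hf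
    · exact integrable_smul_halfLine (memLp_cutoffNearZero n h1) hf
  have hL := (tendsto_integral_concentrating_smul contDiff_deriv_smoothStep.continuous
    (fun x hx => deriv_smoothStep_eq_zero hx) hψ.continuous 0
    (by simpa using (Asymptotics.isLittleO_one_iff ℝ).2 hf0)).add
    (tendsto_integral_cutoffNearZero_smul h1 hf)
  have hR := (tendsto_integral_cutoffNearZero_smul h0 hg).neg
  have := tendsto_nhds_unique (hL.congr' hid) hR
  simpa using this

/-- If `f` vanishes to first order at the origin, then its second weak derivative may be tested
against functions which do not vanish there. -/
theorem AxonalTransport.IsH2Jet.integral_deriv_smul_of_isLittleO {f g h : ℝ → E}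
    (hj : IsH2Jet f g h) (hf0 : f =o[𝓝[>] 0] fun x : ℝ => x) {ψ : ℝ → ℝ} (hψ : ContDiff ℝ ∞ ψ)
    (h0 : MemLp ψ 2 halfLine) (h1 : MemLp (deriv ψ) 2 halfLine)
    (h2 : MemLp (deriv (deriv ψ)) 2 halfLine) :
    ∫ x, deriv ψ x • g x ∂halfLine = -∫ x, ψ x • h x ∂halfLine := by
  have hψ' := (contDiff_infty_iff_deriv.1 hψ).2
  have hf1 : Tendsto f (𝓝[>] 0) (𝓝 0) :=
    (hf0.trans_tendsto (tendsto_id.mono_left nhdsWithin_le_nhds))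
  -- Both derivatives are moved onto the cut-off ψ, so the concentrating terms involve only f: n²
  -- against f = o(x), and n against f → 0. No boundary value of g is needed. In the limit ∫ ψ'' f =
  -- ∫ ψ h, and the first-order identity for ψ' converts the left side to -∫ ψ' g.
  have hid : ∀ᶠ n : ℕ in atTop,
      ∫ x, ((n : ℝ) ^ (1 + 1) * deriv (deriv smoothStep) (n * x) * ψ x) • f x ∂halfLine +
        (2 : ℝ) • ∫ x, ((n : ℝ) ^ (0 + 1) * deriv smoothStep (n * x) * deriv ψ x) • f x ∂halfLine +
        ∫ x, cutoffNearZero (deriv (deriv ψ)) n x • f x ∂halfLine =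
      ∫ x, cutoffNearZero ψ n x • h x ∂halfLine := by
    filter_upwards [eventually_gt_atTop 0] with n hn
    have hn1 := memLp_deriv_cutoffNearZero n hψ h0 h1
    have hsm := contDiff_cutoffNearZero n hψ
    have e1 := hj.deriv_two.integral_deriv_smul hj.memLp_one hj.memLp_two hsm
      (tsupport_cutoffNearZero n hn) (memLp_cutoffNearZero n h0) hn1
    have e2 := hj.deriv_one.integral_deriv_smul hj.memLp_zero hj.memLp_one
      (contDiff_infty_iff_deriv.1 hsm).2
      (tsupport_deriv_subset.trans (tsupport_cutoffNearZero n hn)) hn1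
      (memLp_deriv_deriv_cutoffNearZero n hψ h0 h1 h2)
    rw [e1, neg_neg, deriv_deriv_cutoffNearZero n hψ] at e2
    have i1 := integrable_smul_halfLine (memLp_deriv_deriv_smoothStep_mul n h0) hj.memLp_zero
    have i2 := integrable_smul_halfLine (memLp_deriv_smoothStep_mul n h1) hj.memLp_zero
    have i3 := integrable_smul_halfLine (memLp_cutoffNearZero n h2) hj.memLp_zero
    rw [← e2]
    simp only [zero_add, pow_one, one_add_one_eq_two]
    have i2' : Integrable (fun x => (2 : ℝ) • (n * deriv smoothStep (n * x) * deriv ψ x) • f x)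
      halfLine := i2.smul (2 : ℝ)
    have i12 : Integrable (fun x => ((n : ℝ) ^ 2 * deriv (deriv smoothStep) (n * x) * ψ x) • f x +
      (2 : ℝ) • (n * deriv smoothStep (n * x) * deriv ψ x) • f x) halfLine := i1.add i2'
    rw [← integral_smul, ← integral_add i1 i2', ← integral_add i12 i3]
    refine integral_congr_ae (Eventually.of_forall fun x => ?_)
    simp only [cutoffNearZero, add_smul, smul_smul]
  have hL := ((tendsto_integral_concentrating_smul
    (contDiff_infty_iff_deriv.1 contDiff_deriv_smoothStep).2.continuous
    (fun x hx => deriv_deriv_smoothStep_eq_zero hx) hψ.continuous 1 (by simpa using hf0)).add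
    ((tendsto_integral_concentrating_smul contDiff_deriv_smoothStep.continuous
    (fun x hx => deriv_smoothStep_eq_zero hx) hψ'.continuous 0
    (by simpa using (Asymptotics.isLittleO_one_iff ℝ).2 hf1)).const_smul (2 : ℝ))).add
    (tendsto_integral_cutoffNearZero_smul h2 hj.memLp_zero)
  have hR := tendsto_integral_cutoffNearZero_smul h0 hj.memLp_two
  have hlim := tendsto_nhds_unique (hL.congr' hid) hR
  have hone := hj.deriv_one.integral_deriv_smul_of_tendsto_zero hj.memLp_zero hj.memLp_one hf1 hψ'
    h1 h2
  rw [← hlim, eq_neg_iff_add_eq_zero, add_comm]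
  simp [hone]

end Extension

/-! ### Bounded linear maps acting on H² -/

section Composition

theorem eLpNorm_clm_comp_le {E G : Type*} [NormedAddCommGroup E] [NormedSpace ℝ E]
    [NormedAddCommGroup G] [NormedSpace ℝ G] (A : E →L[ℝ] G) (f : ℝ → E) (p : ℝ≥0∞) (μ : Measure ℝ) :
    eLpNorm (fun x => A (f x)) p μ ≤ ‖A‖ₑ * eLpNorm f p μ := by
  have h := eLpNorm_le_nnreal_smul_eLpNorm_of_ae_le_mul (μ := μ) (f := fun x => A (f x)) (g := f)
    (c := ‖A‖₊) (Eventually.of_forall fun x => A.le_opNNNorm (f x)) p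
  exact h

variable {E G : Type*} [NormedAddCommGroup E] [NormedSpace ℝ E] [CompleteSpace E]
  [NormedAddCommGroup G] [NormedSpace ℝ G] [CompleteSpace G]

theorem AxonalTransport.IsWeakDeriv.clm_comp {f g : ℝ → E} (h : IsWeakDeriv f g)
    (hf : MemLp f 2 halfLine) (hg : MemLp g 2 halfLine) (A : E →L[ℝ] G) :
    IsWeakDeriv (fun x => A (f x)) (fun x => A (g x)) := by
  intro φ hφ hc hs
  have h1 : MemLp φ 2 halfLine := (hφ.continuous.memLp_of_hasCompactSupport hc).restrict _
  have h2 : MemLp (deriv φ) 2 halfLine :=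
    ((hφ.continuous_deriv (by simp)).memLp_of_hasCompactSupport hc.deriv).restrict _
  simp_rw [← A.map_smul]
  rw [A.integral_comp_comm (integrable_smul_halfLine h2 hf),
    A.integral_comp_comm (integrable_smul_halfLine h1 hg), h φ hφ hc hs, map_neg]

theorem AxonalTransport.IsH2Jet.clm_comp {f g h : ℝ → E} (hj : IsH2Jet f g h) (A : E →L[ℝ] G) :
    IsH2Jet (fun x => A (f x)) (fun x => A (g x)) (fun x => A (h x)) where
  memLp_zero := A.comp_memLp' hj.memLp_zero
  memLp_one := A.comp_memLp' hj.memLp_one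
  memLp_two := A.comp_memLp' hj.memLp_two
  deriv_one := hj.deriv_one.clm_comp hj.memLp_zero hj.memLp_one A
  deriv_two := hj.deriv_two.clm_comp hj.memLp_one hj.memLp_two A

theorem AxonalTransport.ContinuousInH2.clm_comp {F : ℝ → ℝ → E} (hF : ContinuousInH2 F)
    (A : E →L[ℝ] G) : ContinuousInH2 fun t x => A (F t x) := by
  obtain ⟨F₁, F₂, hj, hlim⟩ := hF
  refine ⟨fun t x => A (F₁ t x), fun t x => A (F₂ t x), fun t ht => (hj t ht).clm_comp A,
    fun t ht => ?_⟩
  have h := ENNReal.Tendsto.const_mul (a := ‖A‖ₑ) (hlim t ht) (Or.inr enorm_ne_top)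
  rw [mul_zero] at h
  refine tendsto_of_tendsto_of_tendsto_of_le_of_le tendsto_const_nhds h (fun _ => zero_le)
    fun s => ?_
  simp only [mul_add]
  have key : ∀ f g : ℝ → E, eLpNorm ((fun x => A (f x)) - fun x => A (g x)) 2 halfLine ≤
      ‖A‖ₑ * eLpNorm (f - g) 2 halfLine := fun f g => by
    have := eLpNorm_clm_comp_le A (f - g) 2 halfLine
    simp only [Pi.sub_apply, map_sub] at this
    exact this
  exact add_le_add (add_le_add (key _ _) (key _ _)) (key _ _)

end Composition

/-! ### Restriction to the half-line and extension by zero -/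

section LineHalfLine

variable {F : Type*} [NormedAddCommGroup F] [InnerProductSpace ℂ F]

/-- Weak derivatives on the line restrict to the half-line. -/
theorem IsSchwartzWeakDeriv.isWeakDeriv {f g : ℝ → F} (h : IsSchwartzWeakDeriv f g) :
    IsWeakDeriv f g := by
  intro φ hφ hc hs
  have h₁ : HasCompactSupport (Complex.ofRealCLM ∘ φ) := hc.comp_left rfl
  have h₂ : ContDiff ℝ ∞ (Complex.ofRealCLM ∘ φ) := by fun_prop
  have hd : ∀ x, deriv (h₁.toSchwartzMap h₂) x = ((deriv φ x : ℝ) : ℂ) := fun x =>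
    (Complex.ofRealCLM.hasFDerivAt.comp_hasDerivAt x
      (hφ.differentiable (by simp) x).hasDerivAt).deriv
  have key := h (h₁.toSchwartzMap h₂)
  simp_rw [hd] at key
  have hv : ∀ x, h₁.toSchwartzMap h₂ x = ((φ x : ℝ) : ℂ) := fun x => rfl
  simp_rw [hv, Complex.coe_smul] at key
  rw [halfLine, setIntegral_eq_integral_of_forall_compl_eq_zero,
    setIntegral_eq_integral_of_forall_compl_eq_zero, key]
  · intro x hx
    rw [image_eq_zero_of_notMem_tsupport fun hm => hx (hs hm), zero_smul]
  · intro x hx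
    rw [image_eq_zero_of_notMem_tsupport fun hm => hx (hs (tsupport_deriv_subset hm)), zero_smul]

theorem hasDerivAt_re_schwartz (φ : 𝓢(ℝ, ℂ)) (x : ℝ) :
    HasDerivAt (fun y => (φ y).re) (deriv φ x).re x :=
  Complex.reCLM.hasFDerivAt.comp_hasDerivAt x φ.differentiableAt.hasDerivAt

theorem hasDerivAt_im_schwartz (φ : 𝓢(ℝ, ℂ)) (x : ℝ) :
    HasDerivAt (fun y => (φ y).im) (deriv φ x).im x :=
  Complex.imCLM.hasFDerivAt.comp_hasDerivAt x φ.differentiableAt.hasDerivAt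

theorem memLp_re_schwartz (φ : 𝓢(ℝ, ℂ)) : MemLp (fun x => (φ x).re) 2 halfLine :=
  Complex.reCLM.comp_memLp' ((φ.memLp 2 volume).restrict _)

theorem memLp_im_schwartz (φ : 𝓢(ℝ, ℂ)) : MemLp (fun x => (φ x).im) 2 halfLine :=
  Complex.imCLM.comp_memLp' ((φ.memLp 2 volume).restrict _)

/-- Schwartz functions are complex while test functions on the half-line are real; the splitting
bridges the two. -/
theorem integral_schwartz_smul_indicator (φ : 𝓢(ℝ, ℂ)) {f : ℝ → F} (hf : MemLp f 2 halfLine) :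
    ∫ x, φ x • (Ioi 0).indicator f x = (∫ x, (φ x).re • f x ∂halfLine) +
      Complex.I • ∫ x, (φ x).im • f x ∂halfLine := by
  have h1 : ∀ x, φ x • (Ioi 0).indicator f x = (Ioi 0).indicator (fun x => φ x • f x) x := fun x =>
    (congrFun (indicator_smul (Ioi 0) (fun x => φ x) f) x).symm
  simp_rw [h1]
  rw [integral_indicator measurableSet_Ioi, ← integral_smul, ← integral_add
    (integrable_smul_halfLine (memLp_re_schwartz φ) hf)]
  · refine integral_congr_ae (Eventually.of_forall fun x => ?_)
    have h2 : φ x • f x = (((φ x).re : ℂ) + ((φ x).im : ℂ) * Complex.I) • f x := by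
      rw [Complex.re_add_im]
    simp only [h2, add_smul, Complex.coe_smul, mul_smul]
    rw [smul_comm]
  · exact (integrable_smul_halfLine (memLp_im_schwartz φ) hf).smul Complex.I

/-- Zero extension preserves a weak derivative if the half-line identity holds for test functions
that need not vanish at the origin. -/
theorem isSchwartzWeakDeriv_indicator {f g : ℝ → F} (hf : MemLp f 2 halfLine)
    (hg : MemLp g 2 halfLine)
    (h : ∀ ψ : ℝ → ℝ, ContDiff ℝ ∞ ψ → MemLp ψ 2 halfLine → MemLp (deriv ψ) 2 halfLine →
      MemLp (deriv (deriv ψ)) 2 halfLine →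
      ∫ x, deriv ψ x • f x ∂halfLine = -∫ x, ψ x • g x ∂halfLine) :
    IsSchwartzWeakDeriv ((Ioi 0).indicator f) ((Ioi 0).indicator g) := by
  intro φ
  set φ₁ : 𝓢(ℝ, ℂ) := SchwartzMap.derivCLM ℂ ℂ φ with hφ₁
  set φ₂ : 𝓢(ℝ, ℂ) := SchwartzMap.derivCLM ℂ ℂ φ₁ with hφ₂
  have e1 : ∀ x, deriv φ x = φ₁ x := fun x => rfl
  have r1 : deriv (fun y => (φ y).re) = fun x => (φ₁ x).re :=
    funext fun x => (hasDerivAt_re_schwartz φ x).deriv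
  have r2 : deriv (fun y => (φ₁ y).re) = fun x => (φ₂ x).re :=
    funext fun x => (hasDerivAt_re_schwartz φ₁ x).deriv
  have i1 : deriv (fun y => (φ y).im) = fun x => (φ₁ x).im :=
    funext fun x => (hasDerivAt_im_schwartz φ x).deriv
  have i2 : deriv (fun y => (φ₁ y).im) = fun x => (φ₂ x).im :=
    funext fun x => (hasDerivAt_im_schwartz φ₁ x).deriv
  have hre := h (fun y => (φ y).re) (Complex.reCLM.contDiff.comp (φ.smooth ⊤))
    (memLp_re_schwartz φ) (by rw [r1]; exact memLp_re_schwartz φ₁)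
    (by rw [r1, r2]; exact memLp_re_schwartz φ₂)
  have him := h (fun y => (φ y).im) (Complex.imCLM.contDiff.comp (φ.smooth ⊤))
    (memLp_im_schwartz φ) (by rw [i1]; exact memLp_im_schwartz φ₁)
    (by rw [i1, i2]; exact memLp_im_schwartz φ₂)
  rw [r1] at hre
  rw [i1] at him
  simp_rw [e1]
  rw [integral_schwartz_smul_indicator φ₁ hf, integral_schwartz_smul_indicator φ hg, hre, him,
    smul_neg, neg_add]

end LineHalfLine

/-! ### H² regularity through the Fourier transform -/

section Regularity

variable {F : Type*} [NormedAddCommGroup F] [InnerProductSpace ℂ F]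

/-- Pointwise form of Cauchy-Schwarz: 2‖p‖ ≤ (1 + ξ²)⁻¹ + (1 + ξ²)‖p‖². -/
theorem integrable_of_memLp_two_of_memLp_smul {p : ℝ → F} (hp : MemLp p 2 volume)
    (hp' : MemLp (fun ξ : ℝ => ξ • p ξ) 2 volume) : Integrable p volume := by
  refine ((integrable_inv_one_add_sq.add ((hp.integrable_norm_pow two_ne_zero).add
    (hp'.integrable_norm_pow two_ne_zero)))).mono' hp.1 (Eventually.of_forall fun ξ => ?_)
  simp only [Pi.add_apply, norm_smul, Real.norm_eq_abs, mul_pow, sq_abs]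
  have h1 : 0 < 1 + ξ ^ 2 := by positivity
  have h2 : 0 < (1 + ξ ^ 2)⁻¹ := inv_pos.2 h1
  have h3 : (1 + ξ ^ 2)⁻¹ * (1 + ξ ^ 2) = 1 := inv_mul_cancel₀ h1.ne'
  have h4 : 0 ≤ (1 + ξ ^ 2) * ((1 + ξ ^ 2)⁻¹ - ‖p ξ‖) ^ 2 := by positivity
  have h5 : (1 + ξ ^ 2) * ((1 + ξ ^ 2)⁻¹ - ‖p ξ‖) ^ 2 =
      (1 + ξ ^ 2)⁻¹ - 2 * ‖p ξ‖ + (1 + ξ ^ 2) * ‖p ξ‖ ^ 2 := by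
    field_simp
    ring
  nlinarith [norm_nonneg (p ξ)]

theorem memLp_smul_of_memLp_fourierDeriv {p : ℝ → F} {q : ℝ≥0∞} (hp : AEStronglyMeasurable p volume)
    (h : MemLp (fun ξ : ℝ => (2 * Real.pi * ξ * Complex.I : ℂ) • p ξ) q volume) :
    MemLp (fun ξ : ℝ => ξ • p ξ) q volume := by
  refine h.of_le (continuous_id.aestronglyMeasurable.smul hp) (Eventually.of_forall fun ξ => ?_)
  rw [norm_smul, norm_smul]
  refine mul_le_mul_of_nonneg_right ?_ (norm_nonneg _)
  have : ‖(2 * Real.pi * ξ * Complex.I : ℂ)‖ = 2 * Real.pi * |ξ| := by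
    simp [abs_of_pos Real.pi_pos]
  rw [this, Real.norm_eq_abs]
  exact le_mul_of_one_le_left (abs_nonneg _) (by linarith [Real.pi_gt_three])

variable [CompleteSpace F]

/-- A continuous `H²` function on the line is the Fourier integral of a function with two
square-integrable moments. -/
theorem exists_fourierInv_eq {f g h : ℝ → F} (hfc : Continuous f) (hf : MemLp f 2 volume)
    (hg : MemLp g 2 volume) (hh : MemLp h 2 volume) (hfg : IsSchwartzWeakDeriv f g)
    (hgh : IsSchwartzWeakDeriv g h) :
    ∃ w : ℝ → F, MemLp w 2 volume ∧
      MemLp (fun ξ : ℝ => (2 * Real.pi * ξ * Complex.I : ℂ) • w ξ) 2 volume ∧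
      MemLp (fun ξ : ℝ => (2 * Real.pi * ξ * Complex.I : ℂ) •
        (2 * Real.pi * ξ * Complex.I : ℂ) • w ξ) 2 volume ∧ 𝓕⁻ w = f := by
  have e1 := hfg.fourier_ae_eq hf hg
  have e2 := hgh.fourier_ae_eq hg hh
  set W : Lp F 2 (volume : Measure ℝ) := 𝓕 (hf.toLp f) with hW
  set w : ℝ → F := ⇑W with hw
  have hw0 : MemLp w 2 volume := Lp.memLp _
  have hw1 : MemLp (fun ξ : ℝ => (2 * Real.pi * ξ * Complex.I : ℂ) • w ξ) 2 volume :=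
    (memLp_congr_ae e1).1 (Lp.memLp _)
  refine ⟨w, hw0, hw1, (memLp_congr_ae ?_).1
    (Lp.memLp (𝓕 (hh.toLp h) : Lp F 2 (volume : Measure ℝ))), ?_⟩
  · filter_upwards [e1, e2] with ξ h1 h2
    rw [h2, h1]
  · have hint := integrable_of_memLp_two_of_memLp_smul hw0
      (memLp_smul_of_memLp_fourierDeriv hw0.1 hw1)
    have h1 := fourierInv_toLp_ae_eq hw0 hint
    have h2 : hw0.toLp w = 𝓕 (hf.toLp f) := Lp.toLp_coeFn _ _
    rw [h2, FourierTransform.fourierInv_fourier_eq] at h1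
    have hcont : Continuous (𝓕⁻ w) := by
      have h1 : Continuous (𝓕 w) := VectorFourier.fourierIntegral_continuous
        Real.continuous_fourierChar (by fun_prop) hint
      rw [show 𝓕⁻ w = fun x => 𝓕 w (-x) from
        funext fun x => Real.fourierInv_eq_fourier_neg w x]
      fun_prop
    -- Continuity of both sides upgrades almost everywhere equality to equality.
    exact (hcont.ae_eq_iff_eq volume hfc).1 (h1.symm.trans hf.coeFn_toLp)

/-- The Fourier solution is continuous in time with values in `H²`. -/
theorem continuousInH2_fourierSolution {K L : F →L[ℂ] F} {C : ℝ}
    (hC : ∀ t ξ, 0 ≤ t → ‖fourierFlow K L t ξ‖ ≤ C) {w : ℝ → F} (hw0 : MemLp w 2 volume)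
    (hw1 : MemLp (fun ξ : ℝ => (2 * Real.pi * ξ * Complex.I : ℂ) • w ξ) 2 volume)
    (hw2 : MemLp (fun ξ : ℝ => (2 * Real.pi * ξ * Complex.I : ℂ) •
        (2 * Real.pi * ξ * Complex.I : ℂ) • w ξ) 2 volume) :
    ContinuousInH2 fun t x => fourierSolution K L w x t := by
  have hint := integrable_of_memLp_two_of_memLp_smul hw0
    (memLp_smul_of_memLp_fourierDeriv hw0.1 hw1)
  -- The flow is bounded only for nonnegative times; |t| makes the L² class defined for every real
  -- t.
  have hm : ∀ {q : ℝ → F}, MemLp q 2 volume → ∀ t : ℝ,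
      MemLp (fun ξ => fourierFlow K L |t| ξ (q ξ)) 2 volume := fun hq t =>
    memLp_fourierFlow hC hq (abs_nonneg t)
  let Z : ∀ {q : ℝ → F}, MemLp q 2 volume → ℝ → ℝ → F := fun hq t =>
    (𝓕⁻ ((hm hq t).toLp _) : Lp F 2 (volume : Measure ℝ))
  have hZ0 : ∀ t, 0 ≤ t → (fun x => fourierSolution K L w x t) =ᵐ[volume] Z hw0 t := by
    intro t ht
    have h := fourierInv_toLp_ae_eq (hm hw0 t) (integrable_fourierFlow hC hint (abs_nonneg t))
    simp only [Z]
    refine EventuallyEq.trans ?_ h.symm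
    rw [abs_of_nonneg ht]
    exact EventuallyEq.rfl
  have hZm : ∀ {q : ℝ → F} (hq : MemLp q 2 volume) (t : ℝ), MemLp (Z hq t) 2 volume := fun hq t =>
    Lp.memLp _
  have hZd : ∀ {p q : ℝ → F} (hp : MemLp p 2 volume) (hq : MemLp q 2 volume) (t : ℝ),
      (∀ ξ : ℝ, q ξ = (2 * Real.pi * ξ * Complex.I : ℂ) • p ξ) →
      IsSchwartzWeakDeriv (Z hp t) (Z hq t) := fun hp hq t h =>
    isSchwartzWeakDeriv_fourierInv (hm hp t) (hm hq t) fun ξ => by rw [h, map_smul]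
  have hZlim : ∀ {q : ℝ → F} (hq : MemLp q 2 volume) (t : ℝ), 0 ≤ t →
      Tendsto (fun s => eLpNorm (Z hq s - Z hq t) 2 halfLine) (𝓝[Ici 0] t) (𝓝 0) := by
    intro q hq t ht
    refine tendsto_of_tendsto_of_tendsto_of_le_of_le' tendsto_const_nhds
      (tendsto_eLpNorm_fourierFlow_sub hC hq ht) (Eventually.of_forall fun _ => zero_le) ?_
    filter_upwards [self_mem_nhdsWithin] with s hs
    refine (eLpNorm_mono_measure _ Measure.restrict_le_self).trans_eq ?_
    refine (eLpNorm_fourierInv_sub (hm hq s) (hm hq t)).trans ?_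
    rw [abs_of_nonneg ht, abs_of_nonneg (mem_Ici.1 hs)]
  refine ⟨Z hw1, Z hw2, fun t ht => ?_, fun t ht => ?_⟩
  · have h0 : MemLp (fun x => fourierSolution K L w x t) 2 volume :=
      (memLp_congr_ae (hZ0 t ht)).2 (hZm hw0 t)
    refine ⟨h0.restrict _, (hZm hw1 t).restrict _, (hZm hw2 t).restrict _,
      IsSchwartzWeakDeriv.isWeakDeriv fun φ => ?_,
      (hZd hw1 hw2 t fun ξ => rfl).isWeakDeriv⟩
    rw [← hZd hw0 hw1 t (fun ξ => rfl) φ]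
    refine integral_congr_ae ?_
    filter_upwards [hZ0 t ht] with x hx
    rw [hx]
  · have h0 : Tendsto (fun s => eLpNorm ((fun x => fourierSolution K L w x s) -
        fun x => fourierSolution K L w x t) 2 halfLine) (𝓝[Ici 0] t) (𝓝 0) := by
      refine (hZlim hw0 t ht).congr' ?_
      filter_upwards [self_mem_nhdsWithin] with s hs
      exact eLpNorm_congr_ae (ae_restrict_of_ae ((hZ0 s hs).symm.sub (hZ0 t ht).symm))
    simpa using (h0.add (hZlim hw1 t ht)).add (hZlim hw2 t ht)

end Regularity

/-! ### Passage between real and complex vectors, and uniqueness -/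

section RealComplex

variable (r : ℕ)

/-- Coordinatewise inclusion of real into complex vectors. -/
noncomputable def euclideanOfReal : EuclideanSpace ℝ (Fin r) →L[ℝ] EuclideanSpace ℂ (Fin r) :=
  LinearMap.toContinuousLinearMap
    { toFun := fun v => WithLp.toLp 2 fun i => (v i : ℂ)
      map_add' := fun v w => by ext i; simp
      map_smul' := fun c v => by ext i; simp }

/-- Coordinatewise real part. -/
noncomputable def euclideanRe : EuclideanSpace ℂ (Fin r) →L[ℝ] EuclideanSpace ℝ (Fin r) :=
  LinearMap.toContinuousLinearMap
    { toFun := fun v => WithLp.toLp 2 fun i => (v i).re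
      map_add' := fun v w => by ext i; simp
      map_smul' := fun c v => by ext i; simp }

variable {r}

@[simp] theorem euclideanOfReal_apply (v : EuclideanSpace ℝ (Fin r)) (i : Fin r) :
    euclideanOfReal r v i = (v i : ℂ) := rfl

@[simp] theorem euclideanRe_apply (v : EuclideanSpace ℂ (Fin r)) (i : Fin r) :
    euclideanRe r v i = (v i).re := rfl

@[simp] theorem euclideanRe_ofReal (v : EuclideanSpace ℝ (Fin r)) :
    euclideanRe r (euclideanOfReal r v) = v := by
  ext i
  simp

end RealComplex

theorem HasDerivAt.euclidean_apply {r : ℕ} {f : ℝ → EuclideanSpace ℝ (Fin r)}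
    {d : EuclideanSpace ℝ (Fin r)} {x : ℝ} (h : HasDerivAt f d x) (i : Fin r) :
    HasDerivAt (fun y => f y i) (d i) x :=
  (EuclideanSpace.proj i : EuclideanSpace ℝ (Fin r) →L[ℝ] ℝ).hasFDerivAt.comp_hasDerivAt x h

theorem ContinuousOn.euclidean_apply {r : ℕ} {X : Type*} [TopologicalSpace X] {s : Set X}
    {f : X → EuclideanSpace ℝ (Fin r)} (h : ContinuousOn f s) (i : Fin r) :
    ContinuousOn (fun y => f y i) s :=
  (EuclideanSpace.proj i : EuclideanSpace ℝ (Fin r) →L[ℝ] ℝ).continuous.comp_continuousOn h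

/-- Classical solutions on the quarter-plane are unique. -/
theorem AxonalTransport.IsSolution.eq {r : ℕ} {lam : Fin r → ℝ} {K : Matrix (Fin r) (Fin r) ℝ}
    (hK : ∀ i j, i ≠ j → 0 ≤ K i j) (hlam : ∀ i, 0 ≤ lam i)
    {U₀ : ℝ → EuclideanSpace ℝ (Fin r)} {U V : ℝ → ℝ → EuclideanSpace ℝ (Fin r)}
    (hU : IsSolution lam K U₀ U) (hV : IsSolution lam K U₀ V) {x t : ℝ} (hx : 0 ≤ x)
    (ht : 0 ≤ t) : U x t = V x t := by
  have key : ∀ {U V : ℝ → ℝ → EuclideanSpace ℝ (Fin r)}, IsSolution lam K U₀ U →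
      IsSolution lam K U₀ V → ∀ i, U x t i - V x t i ≤ 0 := by
    intro U V hU hV i
    have hsub : Icc (0 : ℝ) x ×ˢ Icc (0 : ℝ) t ⊆ Ici 0 ×ˢ Ici 0 :=
      prod_mono (fun y hy => hy.1) fun s hs => hs.1
    -- The right edge needs no data, so a finite rectangle with corner (x, t) suffices.
    refine transport_maximum_principle lam K hK hlam (a := 0) (b := x) (T := t)
      (fun y s j => U y s j - V y s j) (fun j => ?_) (fun y hy s hs j => ?_) (fun y hy j => ?_)
      (fun s hs j => ?_) x ⟨hx, le_rfl⟩ t ⟨ht, le_rfl⟩ i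
    · exact ((hU.continuousOn.mono hsub).euclidean_apply j).sub
        ((hV.continuousOn.mono hsub).euclidean_apply j)
    · obtain ⟨ut, ux, hut, hux, hu⟩ := hU.equation y s hy.1 hs.1
      obtain ⟨vt, vx, hvt, hvx, hv⟩ := hV.equation y s hy.1 hs.1
      refine ⟨ut j - vt j, ux j - vx j, (hut.euclidean_apply j).sub (hvt.euclidean_apply j),
        (hux.euclidean_apply j).sub (hvx.euclidean_apply j), le_of_eq ?_⟩
      simp only [mul_sub, Finset.sum_sub_distrib]
      rw [← hu j, ← hv j]
      ring
    · rw [hU.initial y hy.1, hV.initial y hy.1, sub_self]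
    · rw [hU.boundary s hs.1, hV.boundary s hs.1, sub_self]
  ext i
  linarith [key hU hV i, key hV hU i]

/-- The real part of the Fourier solution solves the real system. -/
theorem re_fourierSolution_equation {r : ℕ} {lam : Fin r → ℝ} {K : Matrix (Fin r) (Fin r) ℝ}
    {C : ℝ} (hC : ∀ t ξ, 0 ≤ t →
      ‖fourierFlow (complexOp K) (complexOp (Matrix.diagonal lam)) t ξ‖ ≤ C)
    {w : ℝ → EuclideanSpace ℂ (Fin r)} (hw : Integrable w volume)
    (hw' : Integrable (fun ξ : ℝ => ξ • w ξ) volume) (x : ℝ) {t : ℝ} (ht : 0 < t) :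
    ∃ ut ux : EuclideanSpace ℝ (Fin r),
      HasDerivAt (fun s => euclideanRe r
        (fourierSolution (complexOp K) (complexOp (Matrix.diagonal lam)) w x s)) ut t ∧
      HasDerivAt (fun y => euclideanRe r
        (fourierSolution (complexOp K) (complexOp (Matrix.diagonal lam)) w y t)) ux x ∧
      ∀ i, ut i + lam i * ux i = ∑ j, K i j * euclideanRe r
        (fourierSolution (complexOp K) (complexOp (Matrix.diagonal lam)) w x t) j := by
  obtain ⟨ut, ux, hut, hux, h⟩ := fourierSolution_equation hC hw hw' x ht
  refine ⟨euclideanRe r ut, euclideanRe r ux,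
    (euclideanRe r).hasFDerivAt.comp_hasDerivAt t hut,
    (euclideanRe r).hasFDerivAt.comp_hasDerivAt x hux, fun i => ?_⟩
  have hi := congrArg (fun v : EuclideanSpace ℂ (Fin r) => (v i).re) h
  simp only [PiLp.add_apply] at hi
  rw [complexOp_diagonal_apply, complexOp_apply] at hi
  simpa using hi

/-- If the initial value vanishes on the left half-line, then so does the real part of the Fourier
solution at all later times. -/
theorem re_fourierSolution_eq_zero {r : ℕ} {lam : Fin r → ℝ} {K : Matrix (Fin r) (Fin r) ℝ}
    (hK : ∀ i j, i ≠ j → 0 ≤ K i j) (hlam : ∀ i, 0 ≤ lam i)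
    {C : ℝ} (hC : ∀ t ξ, 0 ≤ t →
      ‖fourierFlow (complexOp K) (complexOp (Matrix.diagonal lam)) t ξ‖ ≤ C)
    {w : ℝ → EuclideanSpace ℂ (Fin r)} (hw : Integrable w volume)
    (hw' : Integrable (fun ξ : ℝ => ξ • w ξ) volume)
    (h0 : ∀ x ≤ 0, euclideanRe r
      (fourierSolution (complexOp K) (complexOp (Matrix.diagonal lam)) w x 0) = 0)
    {x t : ℝ} (hx : x ≤ 0) (ht : 0 ≤ t) : euclideanRe r
      (fourierSolution (complexOp K) (complexOp (Matrix.diagonal lam)) w x t) = 0 := by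
  set V : ℝ → ℝ → EuclideanSpace ℝ (Fin r) := fun x t => euclideanRe r
    (fourierSolution (complexOp K) (complexOp (Matrix.diagonal lam)) w x t) with hVdef
  have hbound : ∀ x t i, 0 ≤ t → |V x t i| ≤ ‖euclideanRe r‖ * ∫ ξ, C * ‖w ξ‖ := by
    intro x t i ht
    refine (PiLp.norm_apply_le (V x t) i).trans ?_
    refine ((euclideanRe r).le_opNorm _).trans ?_
    refine mul_le_mul_of_nonneg_left ((norm_fourierSolution_le w x t).trans ?_) (norm_nonneg _)
    exact integral_mono (integrable_fourierFlow hC hw ht).norm (hw.norm.const_mul C)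
      fun ξ => norm_fourierFlow_apply_le hC ht ξ _
  have hcont : ContinuousOn (fun p : ℝ × ℝ => V p.1 p.2) (univ ×ˢ Ici 0) :=
    (euclideanRe r).continuous.comp_continuousOn (continuousOn_fourierSolution hC hw)
  have heq := fun x t ht => re_fourierSolution_equation (lam := lam) (K := K) hC hw hw' x (t := t) ht
  -- The principle is one-sided, so it is applied to V and to -V.
  have hpos := transport_nonpos_of_bounded lam K hK hlam (fun x t i => V x t i)
    (fun x t i ht => (abs_le.1 (hbound x t i ht)).2) (fun i => hcont.euclidean_apply i)
    (fun x t ht i => by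
      obtain ⟨ut, ux, hut, hux, h⟩ := heq x t ht
      exact ⟨ut i, ux i, hut.euclidean_apply i, hux.euclidean_apply i, h i⟩)
    (fun x hx i => by simp [hVdef, h0 x hx]) x hx t ht
  have hneg := transport_nonpos_of_bounded lam K hK hlam (fun x t i => -V x t i)
    (fun x t i ht => neg_le.1 (abs_le.1 (hbound x t i ht)).1)
    (fun i => (hcont.euclidean_apply i).neg)
    (fun x t ht i => by
      obtain ⟨ut, ux, hut, hux, h⟩ := heq x t ht
      refine ⟨-ut i, -ux i, (hut.euclidean_apply i).neg, (hux.euclidean_apply i).neg, ?_⟩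
      simp only [mul_neg, Finset.sum_neg_distrib]
      rw [← h i]
      ring)
    (fun x hx i => by simp [hVdef, h0 x hx]) x hx t ht
  ext i
  have h1 := hpos i
  have h2 := hneg i
  simp only [PiLp.zero_apply]
  exact le_antisymm h1 (neg_nonpos.1 h2)

/-! ### The main theorem -/

theorem theorem3p2 {r : ℕ} (lam : Fin r → ℝ) (K : Matrix (Fin r) (Fin r) ℝ)
    (H1 : ∀ i j, i ≠ j → 0 ≤ K i j)
    (H2 : ∀ j, ∑ i, K i j = 0)
    (H3 : ∀ i₀ i₁, i₀ ≠ i₁ → Relation.TransGen (fun i j => 0 < K i j) i₀ i₁)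
    (H4 : ∃ i j, lam i ≠ lam j)
    (H5 : ∀ i, 0 < lam i)
    (U₀ B : ℝ → EuclideanSpace ℝ (Fin r))
    (hU₀ : ContinuousOn U₀ (Ici 0))
    (hB : IsSteadySolution lam K B) (hB₀ : B 0 = U₀ 0)
    (hH2 : MemH2 (fun x => U₀ x - B x))
    (hcompat : Compatible lam K U₀) :
    (∃ C : ℝ, ∀ x, 0 ≤ x → ‖B x‖ ≤ C) ∧
    ∃ U : ℝ → ℝ → EuclideanSpace ℝ (Fin r),
      (IsSolution lam K U₀ U ∧ ContinuousInH2 (fun t x => U x t - B x)) ∧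
      (∀ V : ℝ → ℝ → EuclideanSpace ℝ (Fin r),
        IsSolution lam K U₀ V → ContinuousInH2 (fun t x => V x t - B x) →
          ∀ x t, 0 ≤ x → 0 ≤ t → V x t = U x t) ∧
      Tendsto (fun t => ⨆ x ∈ Ici (0 : ℝ), ‖U x t - B x‖ₑ) atTop (𝓝 0) := by
  have : Nonempty (Fin r) := ⟨H4.choose⟩
  obtain ⟨p, hp, hKp⟩ := exists_pos_stationary H1 H2 H3
  refine ⟨hB.bounded H1 H2 H5 hp hKp, ?_⟩
  obtain ⟨C, hC⟩ := exists_norm_fourierFlow_le (lam := lam) H1 H2 hp hKp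
  have hdecay := fun ξ (hξ : ξ ≠ 0) => tendsto_fourierFlow_atTop H1 H2 H3 hp hKp H4 hξ
  have hBc : ContinuousOn B (Ici 0) := fun x hx => by
    obtain ⟨d, hd, -⟩ := hB x hx
    exact hd.continuousWithinAt
  set v : ℝ → EuclideanSpace ℝ (Fin r) := fun x => U₀ x - B x with hv
  have hv0 : v 0 = 0 := by simp [hv, hB₀]
  have hvc : ContinuousOn v (Ici 0) := hU₀.sub hBc
  -- U₀ and B have the same right derivative at 0, because every lam i is nonzero.
  have hvo : v =o[𝓝[>] 0] fun x : ℝ => x := by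
    obtain ⟨d, hd, hde⟩ := hcompat
    obtain ⟨e, he, hee⟩ := hB 0 le_rfl
    have hdeq : d = e := by
      ext i
      refine mul_left_cancel₀ (H5 i).ne' ?_
      rw [hde, hee, hB₀]
    have h1 := (hd.sub he).isLittleO
    rw [hdeq, sub_self] at h1
    have h2 : v =o[𝓝[≥] 0] fun x : ℝ => x := by
      refine h1.congr (fun x => ?_) fun x => sub_zero x
      simp [hv, hB₀]
    exact h2.mono (nhdsWithin_mono _ Ioi_subset_Ici_self)
  obtain ⟨g, h, hj⟩ := hH2
  have hjc := hj.clm_comp (euclideanOfReal r)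
  have hvo' : (fun x => euclideanOfReal r (v x)) =o[𝓝[>] 0] fun x : ℝ => x :=
    ((euclideanOfReal r).isBigO_comp v _).trans_isLittleO hvo
  have hd1 := isSchwartzWeakDeriv_indicator hjc.memLp_zero hjc.memLp_one fun ψ hψ h0 h1 _ =>
    hjc.deriv_one.integral_deriv_smul_of_tendsto_zero hjc.memLp_zero hjc.memLp_one
      (hvo'.trans_tendsto (tendsto_id.mono_left nhdsWithin_le_nhds)) hψ h0 h1
  have hd2 := isSchwartzWeakDeriv_indicator hjc.memLp_one hjc.memLp_two fun ψ hψ h0 h1 h2 =>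
    hjc.integral_deriv_smul_of_isLittleO hvo' hψ h0 h1 h2
  have hind : ∀ x, (Ioi 0).indicator (fun x => euclideanOfReal r (v x)) x =
      euclideanOfReal r (v (max x 0)) := fun x => by
    rcases le_or_gt x 0 with hx | hx
    · rw [indicator_of_notMem (by simpa using hx), max_eq_right hx, hv0, map_zero]
    · rw [indicator_of_mem (mem_Ioi.2 hx), max_eq_left hx.le]
  have hcont : Continuous ((Ioi 0).indicator fun x => euclideanOfReal r (v x)) := by
    rw [funext hind]
    exact (euclideanOfReal r).continuous.comp
      (hvc.comp_continuous (by fun_prop) fun x => le_max_right x 0)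
  obtain ⟨w, hw0, hw1, hw2, hw⟩ := exists_fourierInv_eq hcont
    ((memLp_indicator_iff_restrict measurableSet_Ioi).2 hjc.memLp_zero)
    ((memLp_indicator_iff_restrict measurableSet_Ioi).2 hjc.memLp_one)
    ((memLp_indicator_iff_restrict measurableSet_Ioi).2 hjc.memLp_two) hd1 hd2
  have hs1 := memLp_smul_of_memLp_fourierDeriv hw0.1 hw1
  have hwint : Integrable w volume := integrable_of_memLp_two_of_memLp_smul hw0 hs1
  -- The integrability criterion again, now for ξ w; this uses the second moment.
  have hwint' : Integrable (fun ξ : ℝ => ξ • w ξ) volume := by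
    refine integrable_of_memLp_two_of_memLp_smul hs1 ?_
    have h1 := memLp_smul_of_memLp_fourierDeriv hw1.1 hw2
    refine memLp_smul_of_memLp_fourierDeriv hs1.1 (h1.congr_norm ?_ ?_)
    · exact (by fun_prop : Continuous fun ξ : ℝ =>
        (2 * Real.pi * ξ * Complex.I : ℂ)).aestronglyMeasurable.smul hs1.1
    · refine Eventually.of_forall fun ξ => ?_
      rw [smul_comm]
  -- K and Λ are real, so the real part solves the system, and at time 0 it is the zero extension of
  -- v.
  set V : ℝ → ℝ → EuclideanSpace ℝ (Fin r) := fun x t => euclideanRe r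
    (fourierSolution (complexOp K) (complexOp (Matrix.diagonal lam)) w x t) with hV
  have hVinit : ∀ x, V x 0 = v (max x 0) := fun x => by
    simp only [hV, fourierSolution, fourierFlow_zero, one_apply_eq_self]
    rw [hw, hind, euclideanRe_ofReal]
  have hVleft : ∀ t, 0 ≤ t → V 0 t = 0 := fun t ht =>
    re_fourierSolution_eq_zero H1 (fun i => (H5 i).le) hC hwint hwint'
      (fun x hx => by
        have := hVinit x
        rwa [max_eq_right hx, hv0] at this) le_rfl ht
  have hVeq := fun x t ht =>
    re_fourierSolution_equation (lam := lam) (K := K) hC hwint hwint' x (t := t) ht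
  have hVcont : ContinuousOn (fun p : ℝ × ℝ => V p.1 p.2) (univ ×ˢ Ici 0) :=
    (euclideanRe r).continuous.comp_continuousOn (continuousOn_fourierSolution hC hwint)
  have hsol : IsSolution lam K U₀ fun x t => V x t + B x := by
    refine ⟨?_, fun x t hx ht => ?_, fun x hx => ?_, fun t ht => ?_⟩
    · exact (hVcont.mono (prod_mono (subset_univ _) subset_rfl)).add
        (hBc.comp continuousOn_fst fun q hq => hq.1)
    · obtain ⟨ut, ux, hut, hux, he⟩ := hVeq x t ht
      obtain ⟨d, hd, hde⟩ := hB x hx.le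
      refine ⟨ut, ux + d, hut.add_const _, hux.add (hd.hasDerivAt (Ici_mem_nhds hx)), fun i => ?_⟩
      simp only [PiLp.add_apply, mul_add, Finset.sum_add_distrib]
      rw [← he i, ← hde i]
      ring
    · rw [hVinit, max_eq_left hx, hv, sub_add_cancel]
    · rw [hVleft t ht, zero_add, hB₀]
  have hVB : ∀ x t, V x t + B x - B x = V x t := fun x t => add_sub_cancel_right _ _
  refine ⟨fun x t => V x t + B x, ⟨hsol, ?_⟩, fun V' hV' _ x t hx ht =>
    hV'.eq H1 (fun i => (H5 i).le) hsol hx ht, ?_⟩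
  · simp_rw [hVB]
    exact (continuousInH2_fourierSolution hC hw0 hw1 hw2).clm_comp (euclideanRe r)
  · simp_rw [hVB]
    have hlim := (tendsto_integral_norm_fourierFlow hC hdecay hwint).const_mul ‖euclideanRe r‖
    rw [mul_zero] at hlim
    have hlim' := ENNReal.tendsto_ofReal hlim
    rw [ENNReal.ofReal_zero] at hlim'
    refine tendsto_of_tendsto_of_tendsto_of_le_of_le tendsto_const_nhds hlim' (fun _ => zero_le)
      fun t => iSup₂_le fun x _ => ?_
    rw [← ofReal_norm]
    refine ENNReal.ofReal_le_ofReal (((euclideanRe r).le_opNorm _).trans ?_)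
    exact mul_le_mul_of_nonneg_left (norm_fourierSolution_le w x t) (norm_nonneg _)
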